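/- Let $(W,S)$ be a Coxeter system with $W$ finite, $S=\{s_i:i\in I\}$, $I$ finite, and $m(i,j)$ the order of $s_is_j$. Let $V=\mathbb R^I$ have standard basis $(\alpha_i)_{i\in I}$ and the bilinear form $B(\alpha_i,\alpha_j)=-\cos(\pi/m(i,j))$, and let $W$ act on $V$ by $s_i\beta=\beta-2B(\beta,\alpha_i)\alpha_i$. Let $\Phi=\{w\alpha_i: w\in W,\ i\in I\}$, and let $\Phi^+$ be the set of those $\beta\in\Phi$ that are nonnegative linear combinations of the $\alpha_i$. For $\beta\in\Phi$ put $H_\beta^+=\{w\in W:w\beta\in\Phi^+\}$, and for nonempty $\mathscr L\subseteq W$ put $\mathrm R(\mathscr L)=\{\beta\in\Phi:\mathscr L\subseteq H_\beta^+\}$. The set $\mathscr L$ is convex if $\mathscr L=\bigcap_{\beta\in\mathrm R(\mathscr L)}H_\beta^+$. For $i\in I$ define $\tau_i\colon W\to W$ by $\tau_i(u)=u$ if $u^{-1}\alpha_i\in\mathrm R(\mathscr L)$ and $\tau_i(u)=s_iu$ otherwise. Let $i_1,\dots,i_n$ be an ordering of $I$ (each element occurring exactly once), let $\mathsf c$ be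 the word $i_n\cdots i_1$, let $c=s_{i_n}\cdots s_{i_1}$ be the corresponding Coxeter element, and let $\mathrm{Pro}_c=\tau_{i_n}\circ\cdots\circ\tau_{i_1}$. Let $\mathrm M(c)$ be the smallest positive integer $k$ such that the $k$-fold concatenation $\mathsf c^k$ contains a reduced word for the longest element $w_\circ$ of $W$ as a (not necessarily consecutive) subword. (a) For every nonempty convex set $\mathscr L\subseteq W$, $$\mathrm{Pro}_c^{\mathrm M(c)}(W)=\mathscr L .$$ (b) Let $n\ge 0$, let $P$ be a partial order $\le_P$ on $[n+1]=\{1,\dots,n+1\}$, and let $\mathcal L(P)$ be the set of permutations $w\in\mathfrak S_{n+1}$ such that $a\le_P b$ implies $w(a)\le w(b)$. For $1\le i\le n$ define $\tau_i\colon\mathfrak S_{n+1}\to\mathfrak S_{n+1}$ by $\tau_i(u)=u$ if $u^{-1}(i)\le_P u^{-1}(i+1)$ and $\tau_i(u)=(i\ \ i{+}1)\,u$ otherwise. Let $\mathrm{Pro}=\tau_n\cdots\tau_2\tau_1$ be extended promotion, and let $\mathrm{Gyr}=\tau_{\mathrm{even}}\tau_{\mathrm{odd}}$ be extended gyration, where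 $\tau_{\mathrm{odd}}$ (respectively $\tau_{\mathrm{even}}$) is the composition of the pairwise commuting maps $\tau_i$ with $i$ odd (respectively even). Then $$\mathrm{Pro}^{\,n}(\mathfrak S_{n+1})=\mathcal L(P)\qquad\text{and}\qquad \mathrm{Gyr}^{\lceil h/2\rceil}(\mathfrak S_{n+1})=\mathcal L(P),$$ where $h=n+1$ is the Coxeter number of $\mathfrak S_{n+1}$. -/

import Mathlib

namespace BenderKnuth

/-! ### The standard geometric representation of a Coxeter group and its root system

A word over the index set `I` is a `List I`, written from left to right, so `[i_M, ..., i_1]` stands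
for `i_M ⋯ i_1` and represents the product `s_{i_M} ⋯ s_{i_1}`. In a `CoxeterMatrix` the entry `0`
encodes `m(i, i') = ∞`. -/

section Geometric

variable {I : Type*} (M : CoxeterMatrix I)

/-- The simple root `α_i`, a standard basis vector of the root space `V = ℝ^I`. -/
noncomputable def simpleRoot (i : I) : I →₀ ℝ := Finsupp.single i 1

/-- The symmetric bilinear form with `B(α_i, α_j) = -cos(π / m(i,j))`. For `m(i,j) = ∞`, encoded
as `0`, the value is `-cos 0 = -1`, which is the usual convention. -/
noncomputable def bilin : (I →₀ ℝ) →ₗ[ℝ] (I →₀ ℝ) →ₗ[ℝ] ℝ :=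
  Finsupp.linearCombination ℝ fun i =>
    Finsupp.linearCombination ℝ fun j => -Real.cos (Real.pi / (M i j : ℝ))

theorem bilin_simpleRoot (i j : I) :
    bilin M (simpleRoot i) (simpleRoot j) = -Real.cos (Real.pi / (M i j : ℝ)) := by
  simp [bilin, simpleRoot]

/-- The linear functional `β ↦ 2 B(β, α_i)`. -/
noncomputable def simpleCoroot (i : I) : Module.Dual ℝ (I →₀ ℝ) :=
  (2 : ℝ) • (bilin M).flip (simpleRoot i)

theorem simpleCoroot_apply (i : I) (β : I →₀ ℝ) :
    simpleCoroot M i β = 2 * bilin M β (simpleRoot i) := by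
  simp [simpleCoroot]

theorem simpleCoroot_self (i : I) : simpleCoroot M i (simpleRoot i) = 2 := by
  simp [simpleCoroot_apply, bilin_simpleRoot]

/-- The reflection `β ↦ β - 2 B(β, α_i) α_i`. -/
noncomputable def simpleReflection (i : I) : (I →₀ ℝ) ≃ₗ[ℝ] (I →₀ ℝ) :=
  Module.reflection (simpleCoroot_self M i)

theorem simpleReflection_apply (i : I) (β : I →₀ ℝ) :
    simpleReflection M i β = β - (2 * bilin M β (simpleRoot i)) • simpleRoot i := by
  rw [simpleReflection, Module.reflection_apply, simpleCoroot_apply]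

open Polynomial.Chebyshev in
theorem isLiftable_simpleReflection : M.IsLiftable (simpleReflection M) := by
  intro i j
  by_cases hij : i = j
  · subst hij
    ext1 z
    simpa [simpleReflection] using Module.involutive_reflection (simpleCoroot_self M i) z
  have hsymm : M j i = M i j := M.symmetric j i
  have h1 : M i j ≠ 1 := M.off_diagonal i j hij
  set c := Real.cos (Real.pi / (M i j : ℝ)) with hc
  have hfj : simpleCoroot M i (simpleRoot j) = -2 * c := by
    rw [simpleCoroot_apply, bilin_simpleRoot, hsymm]; ring
  have hgi : simpleCoroot M j (simpleRoot i) = -2 * c := by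
    rw [simpleCoroot_apply, bilin_simpleRoot]; ring
  obtain hm0 | hm2 | hm3 : M i j = 0 ∨ M i j = 2 ∨ 3 ≤ M i j := by omega
  · rw [hm0, pow_zero]
  · ext1 z
    have hc0 : c = 0 := by rw [hc, hm2]; simp
    rw [simpleReflection, simpleReflection, Module.reflection_mul_reflection_pow_apply, hfj, hgi,
      hm2, hc0]
    norm_num
    module
  · ext1 z
    have hmpos : (0 : ℝ) < (M i j : ℝ) := by
      exact_mod_cast (show 0 < M i j by omega)
    set θ : ℝ := 2 * Real.pi / (M i j : ℝ) with hθ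
    have ht : (2 * Real.cos θ : ℝ) =
        simpleCoroot M i (simpleRoot j) * simpleCoroot M j (simpleRoot i) - 2 := by
      rw [hfj, hgi, show θ = 2 * (Real.pi / (M i j : ℝ)) by rw [hθ]; ring, Real.cos_two_mul]
      ring
    have hsin : Real.sin θ ≠ 0 := by
      apply ne_of_gt
      apply Real.sin_pos_of_pos_of_lt_pi
      · positivity
      · rw [hθ, div_lt_iff₀ hmpos]
        have : (3 : ℝ) ≤ (M i j : ℝ) := by exact_mod_cast hm3
        nlinarith [Real.pi_pos]
    rw [simpleReflection, simpleReflection,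
      Module.reflection_mul_reflection_pow_apply _ _ _ _ _ ht]
    obtain ⟨k, hk | hk⟩ : ∃ k : ℕ, M i j = 2 * k ∨ M i j = 2 * k + 1 := ⟨M i j / 2, by omega⟩
    · have hS : (S ℝ ((k : ℤ) - 1)).eval (2 * Real.cos θ) = 0 := by
        have h := S_two_mul_real_cos θ ((k : ℤ) - 1)
        have hang : (((k : ℤ) - 1 : ℤ) + 1 : ℝ) * θ = Real.pi := by
          rw [hθ, hk]
          have : (k : ℝ) ≠ 0 := by
            have : k ≠ 0 := by omega
            exact_mod_cast this
          push_cast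
          field_simp
          try ring
        rw [hang, Real.sin_pi] at h
        exact (mul_eq_zero.mp h).resolve_right hsin
      have e1 : ((M i j : ℤ) - 2) / 2 = (k : ℤ) - 1 := by omega
      have e2 : ((M i j : ℤ) - 1) / 2 = (k : ℤ) - 1 := by omega
      rw [e1, e2, hS]
      simp
    · have hS : (S ℝ (k : ℤ)).eval (2 * Real.cos θ) +
          (S ℝ ((k : ℤ) - 1)).eval (2 * Real.cos θ) = 0 := by
        have h := S_two_mul_real_cos θ ((k : ℤ) - 1)
        have h' := S_two_mul_real_cos θ (k : ℤ)
        have hang : (((k : ℤ) : ℝ) + 1) * θ = 2 * Real.pi - (((k : ℤ) - 1 : ℤ) + 1 : ℝ) * θ := by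
          rw [hθ, hk]
          push_cast
          field_simp
          ring
        rw [hang, Real.sin_two_pi_sub, ← h] at h'
        exact (mul_eq_zero.mp (by linarith : (_ + _) * Real.sin θ = 0)).resolve_right hsin
      have e1 : ((M i j : ℤ) - 2) / 2 = (k : ℤ) - 1 := by omega
      have e2 : ((M i j : ℤ) - 1) / 2 = (k : ℤ) := by omega
      have e3 : ((M i j : ℤ) - 3) / 2 = (k : ℤ) - 1 := by omega
      have e4 : (M i j : ℤ) / 2 = (k : ℤ) := by omega
      rw [e1, e2, e3, e4, hS]
      simp

end Geometric

section CoxeterGroup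

variable {I W : Type*} [Group W] {M : CoxeterMatrix I} (cs : CoxeterSystem M W)

/-- The standard geometric representation of `W` on the root space `V = ℝ^I`. -/
noncomputable def rho : W →* ((I →₀ ℝ) ≃ₗ[ℝ] (I →₀ ℝ)) :=
  cs.lift ⟨simpleReflection M, isLiftable_simpleReflection M⟩

theorem rho_simple (i : I) : rho cs (cs.simple i) = simpleReflection M i :=
  cs.lift_apply_simple (isLiftable_simpleReflection M) i

/-- The root system `Φ = {w α_i}`. -/
def roots : Set (I →₀ ℝ) := {β | ∃ (w : W) (i : I), β = rho cs w (simpleRoot i)}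

/-- The positive roots: those that are nonnegative linear combinations of the simple roots. -/
def posRoots : Set (I →₀ ℝ) := {β | β ∈ roots cs ∧ ∀ i, 0 ≤ β i}

/-- The half-space `H_β^+ = {w ∈ W : w β ∈ Φ^+}`. -/
def halfSpace (β : I →₀ ℝ) : Set W := {w | rho cs w β ∈ posRoots cs}

/-- `R(L) = {β ∈ Φ : L ⊆ H_β^+}`. -/
def rootsOf (L : Set W) : Set (I →₀ ℝ) := {β | β ∈ roots cs ∧ L ⊆ halfSpace cs β}

/-- The convex hull of `L`: the intersection of all half-spaces `H_β^+` that contain `L`. -/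
def hull (L : Set W) : Set W := ⋂ β ∈ rootsOf cs L, halfSpace cs β

/-- `L` is convex if it equals its convex hull. -/
def IsConvex (L : Set W) : Prop := hull cs L = L

open Classical in
/-- The noninvertible Bender--Knuth toggle `τ_i` with respect to `L`. -/
noncomputable def toggle (L : Set W) (i : I) (u : W) : W :=
  if rho cs u⁻¹ (simpleRoot i) ∈ rootsOf cs L then u else cs.simple i * u

/-- The composition `τ_{i_M} ∘ ⋯ ∘ τ_{i_1}` for the word `[i_M, ..., i_1]` (the last letter of the
list acts first). If the word is an ordering of `I` representing the Coxeter element `c`, this is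
the operator `Pro_c`. -/
noncomputable def toggleWord (L : Set W) : List I → W → W
  | [] => id
  | i :: w => toggle cs L i ∘ toggleWord L w

/-- The word `c` contains each letter of `I` exactly once and represents the element `x`, which is
thus a (standard) Coxeter element. -/
def IsCoxeterWordFor (c : List I) (x : W) : Prop :=
  c.Nodup ∧ (∀ i, i ∈ c) ∧ cs.wordProd c = x

/-- `w` is a longest element of `W`. -/
def IsLongElement (w : W) : Prop := ∀ v : W, cs.length v ≤ cs.length w

/-- `M(c)`: the smallest positive `k` such that the concatenation of `k` copies of the word `c`
contains a reduced word for the long element as a (not necessarily consecutive) subword. -/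
noncomputable def minPower (c : List I) : ℕ :=
  sInf {k | 0 < k ∧ ∃ w : List I, w.Sublist (List.replicate k c).flatten ∧
    cs.IsReduced w ∧ IsLongElement cs (cs.wordProd w)}

end CoxeterGroup

/-! ### Toggles on permutations, for a partial order on `[n + 1]`

`Fin (n + 1)` stands for `{1, ..., n + 1}` and `Fin n` for the index set `{1, ..., n}`, both shifted
by one: the element `i : Fin n` is the index `i + 1`. -/

section Permutations

variable {n : ℕ} (r : Fin (n + 1) → Fin (n + 1) → Prop)

/-- The linear extensions of `([n + 1], r)`: permutations `w` with `w(a) ≤ w(b)` whenever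
`r a b`. -/
def linearExtensions : Set (Equiv.Perm (Fin (n + 1))) := {w | ∀ a b, r a b → w a ≤ w b}

open Classical in
/-- The toggle on permutations: `u` is fixed if `u⁻¹(i)` is below `u⁻¹(i + 1)` in the partial
order, and is replaced by `(i  i+1) u` otherwise. -/
noncomputable def permToggle (i : Fin n) (u : Equiv.Perm (Fin (n + 1))) :
    Equiv.Perm (Fin (n + 1)) :=
  if r (u⁻¹ i.castSucc) (u⁻¹ i.succ) then u else Equiv.swap i.castSucc i.succ * u

/-- The composition of toggles along a word; the last letter of the list acts first. -/
noncomputable def permToggleWord :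
    List (Fin n) → Equiv.Perm (Fin (n + 1)) → Equiv.Perm (Fin (n + 1))
  | [] => id
  | i :: w => permToggle r i ∘ permToggleWord w

/-- Extended promotion `τ_n ⋯ τ_2 τ_1`. -/
noncomputable def extPromotion : Equiv.Perm (Fin (n + 1)) → Equiv.Perm (Fin (n + 1)) :=
  permToggleWord r (List.finRange n).reverse

/-- Extended gyration `τ_even τ_odd`: first all toggles with odd index in `{1, ..., n}`, then all
toggles with even index. Toggles whose indices have the same parity commute. -/
noncomputable def extGyration : Equiv.Perm (Fin (n + 1)) → Equiv.Perm (Fin (n + 1)) :=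
  permToggleWord r ((List.finRange n).filter fun i => Even (i.val + 1)) ∘
    permToggleWord r ((List.finRange n).filter fun i => Odd (i.val + 1))

end Permutations

end BenderKnuth

/-!
# Iterated noninvertible Bender--Knuth toggles reach the convex set

One inclusion is easy: every toggle restricts to an involution of `L`, so `L` lies in the image of
every composition of toggles (`toggleWord_image`). For the other inclusion suppose that `w`, the
result of the toggles, is on the wrong side of the wall of some `β ∈ R(L)`. Then `γ = -w β` is a
positive root with `-γ ∈ w R(L)`. Follow such a pair `(w, γ)` backwards in time. A toggle that moves
reflects `γ`; a toggle that is blocked leaves `w` alone, and since `R(L)` is closed under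
nonnegative combinations, `γ` may be kept or, if this lowers it, be reflected
(`exists_wall_before_toggle`).

The contradiction comes from a linear functional `f` that is reflected at *every* letter and stays
positive on `γ`. It starts as a coordinate functional `γ ↦ γ_i`. The choice of `γ` keeps `f γ > 0`
as long as `f` is nonnegative on the simple root of the current letter. For an arbitrary word this
may fail, and the word `c c ⋯ c` for a Coxeter element `c` enters here: once `i` has been read, `f`
equals `-E(η, ·)`, where `E` is the Euler form of the current rotation of `c` and `η` is a positive
root that is reflected along with `f` (`eulerForm_rotate`). The value of `f` on the current simple
root `α_j` is a coordinate of `s_j η`, hence nonnegative unless `η = α_j`; and in that case `f` is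
minus a coordinate functional, so `f γ ≤ 0` (`IsTraced.rotate`). If this never happens, a subword for
the longest element, adapted letter by letter by the exchange property
(`exists_sublist_antidominant`), shows that in the end `f` is nonpositive on all simple roots, so
again `f γ ≤ 0`. Both cases are combined in `trace_nonpos`.

The argument needs that every root is positive or negative, which is proved here for all Coxeter
groups by reduction to dihedral subgroups (`rho_simpleRoot_nonneg`). It also gives the faithfulness
that identifies the symmetric group with the Coxeter group of type `A_n`. There the toggles on
permutations are the toggles of the convex set of linear extensions, and the number of rounds is
bounded by words for the order-reversing permutation: a product of cycles for promotion, and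
`n + 1` alternating rounds of disjoint adjacent transpositions for gyration.
-/

namespace BenderKnuth

/-! ### Positive and negative roots -/

section RootSystem

variable {I W : Type*} [Group W] {M : CoxeterMatrix I} (cs : CoxeterSystem M W)

theorem bilin_comm (u v : I →₀ ℝ) : bilin M u v = bilin M v u := by
  have h : bilin M = (bilin M).flip := by
    ext i j
    simp [bilin, M.symmetric i j]
  exact congrArg (fun F => F u v) h

theorem bilin_simpleRoot_self (i : I) : bilin M (simpleRoot i) (simpleRoot i) = 1 := by
  simp [bilin_simpleRoot]

theorem simpleReflection_simpleRoot_self (i : I) :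
    simpleReflection M i (simpleRoot i) = -simpleRoot i := by
  rw [simpleReflection_apply, bilin_simpleRoot_self]
  module

theorem simpleReflection_simpleReflection (i : I) (β : I →₀ ℝ) :
    simpleReflection M i (simpleReflection M i β) = β :=
  Module.involutive_reflection (simpleCoroot_self M i) β

theorem simpleReflection_apply_of_ne {i k : I} (h : k ≠ i) (β : I →₀ ℝ) :
    simpleReflection M i β k = β k := by
  simp [simpleReflection_apply, simpleRoot, h.symm]

theorem simpleReflection_apply_self (i : I) (β : I →₀ ℝ) :
    simpleReflection M i β i = β i - 2 * bilin M β (simpleRoot i) := by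
  simp [simpleReflection_apply, simpleRoot]

theorem bilin_simpleReflection (i : I) (u v : I →₀ ℝ) :
    bilin M (simpleReflection M i u) (simpleReflection M i v) = bilin M u v := by
  simp only [simpleReflection_apply, map_sub, map_smul, LinearMap.sub_apply, LinearMap.smul_apply,
    smul_eq_mul, bilin_simpleRoot_self, bilin_comm (simpleRoot i) v]
  ring

theorem rho_mul_apply (v w : W) (β : I →₀ ℝ) : rho cs (v * w) β = rho cs v (rho cs w β) := by
  rw [map_mul]; rfl

theorem rho_one_apply (β : I →₀ ℝ) : rho cs 1 β = β := by
  rw [map_one]; rfl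

theorem rho_simple_apply (i : I) (β : I →₀ ℝ) :
    rho cs (cs.simple i) β = simpleReflection M i β := by
  rw [rho_simple]

theorem rho_inv_apply_apply (w : W) (β : I →₀ ℝ) : rho cs w⁻¹ (rho cs w β) = β := by
  rw [← rho_mul_apply, inv_mul_cancel, rho_one_apply]

theorem rho_apply_inv_apply (w : W) (β : I →₀ ℝ) : rho cs w (rho cs w⁻¹ β) = β := by
  rw [← rho_mul_apply, mul_inv_cancel, rho_one_apply]

theorem bilin_rho (w : W) (u v : I →₀ ℝ) :
    bilin M (rho cs w u) (rho cs w v) = bilin M u v := by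
  induction w using cs.simple_induction_left with
  | one => simp
  | mul_simple_left w i h => rw [rho_mul_apply, rho_mul_apply, rho_simple, bilin_simpleReflection, h]

/-- Nonnegative solution, up to index `m`, of the recurrence satisfied by the coefficients of the
roots of a dihedral subsystem of order `2m`; for `m = 0` (infinite order) it is nonnegative
everywhere. -/
theorem exists_dihedral_coeff (m : ℕ) (hm : m ≠ 1) :
    ∃ p : ℕ → ℝ, p 0 = 0 ∧ p 1 = 1 ∧
      (∀ k, p (k + 2) = 2 * Real.cos (Real.pi / m) * p (k + 1) - p k) ∧
      ∀ k, (m = 0 ∨ k ≤ m) → 0 ≤ p k := by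
  rcases Nat.eq_zero_or_pos m with rfl | hpos
  · refine ⟨fun k => k, by simp, by simp, fun k => ?_, fun k _ => by positivity⟩
    simp
    ring
  · have hm2 : 2 ≤ m := by omega
    have hmR : (2 : ℝ) ≤ m := by exact_mod_cast hm2
    set θ := Real.pi / (m : ℝ) with hθ
    have hθ0 : 0 < θ := by positivity
    have hsin : 0 < Real.sin θ := by
      apply Real.sin_pos_of_pos_of_lt_pi hθ0
      rw [hθ, div_lt_iff₀ (by linarith)]
      nlinarith [Real.pi_pos]
    refine ⟨fun k => Real.sin (k * θ) / Real.sin θ, by simp, by simp [hsin.ne'], fun k => ?_,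
      fun k hk => ?_⟩
    · have h1 : ((k + 2 : ℕ) : ℝ) * θ = ((k + 1 : ℕ) : ℝ) * θ + θ := by push_cast; ring
      have h2 : (k : ℝ) * θ = ((k + 1 : ℕ) : ℝ) * θ - θ := by push_cast; ring
      beta_reduce
      rw [h1, h2, Real.sin_add, Real.sin_sub]
      ring
    · refine div_nonneg (Real.sin_nonneg_of_nonneg_of_le_pi (by positivity) ?_) hsin.le
      have hkm : (k : ℝ) ≤ m := by exact_mod_cast (hk.resolve_left hpos.ne')
      calc (k : ℝ) * θ ≤ m * θ := by gcongr
        _ = Real.pi := by rw [hθ]; field_simp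

/-- The roots of a rank two parabolic subsystem in terms of the two simple roots. -/
theorem rho_alternatingWord_simpleRoot (i j : I) {p : ℕ → ℝ} (p0 : p 0 = 0) (p1 : p 1 = 1)
    (hp : ∀ k, p (k + 2) = 2 * Real.cos (Real.pi / (M i j : ℝ)) * p (k + 1) - p k) (m : ℕ) :
    rho cs (cs.wordProd (CoxeterSystem.alternatingWord i j m)) (simpleRoot i) =
        p (m + 1) • simpleRoot (if Even m then i else j) +
          p m • simpleRoot (if Even m then j else i) ∧
    rho cs (cs.wordProd (CoxeterSystem.alternatingWord j i m)) (simpleRoot j) =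
        p (m + 1) • simpleRoot (if Even m then j else i) +
          p m • simpleRoot (if Even m then i else j) := by
  induction m using Nat.twoStepInduction with
  | zero => simp [CoxeterSystem.alternatingWord, p0, p1]
  | one =>
    have h2 := hp 0
    rw [p0, p1] at h2
    have hM : M j i = M i j := M.symmetric j i
    simp only [CoxeterSystem.alternatingWord, List.concat_eq_append, List.nil_append,
      CoxeterSystem.wordProd_singleton, rho_simple, simpleReflection_apply, bilin_simpleRoot,
      Nat.not_even_one, if_false, hM, h2, p1]
    constructor <;> module
  | more m ih1 ih2 =>
    have hM : M j i = M i j := M.symmetric j i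
    have he : Even (m + 2) ↔ Even m := by simp [Nat.even_add]
    have ho : Even (m + 1) ↔ ¬ Even m := by simp [Nat.even_add_one]
    have step : ∀ a b : I, M a b = M i j →
        rho cs (cs.wordProd (CoxeterSystem.alternatingWord a b (m + 2))) (simpleRoot a) =
          (2 * Real.cos (Real.pi / (M i j : ℝ))) •
            rho cs (cs.wordProd (CoxeterSystem.alternatingWord b a (m + 1))) (simpleRoot b) -
          rho cs (cs.wordProd (CoxeterSystem.alternatingWord a b m)) (simpleRoot a) := by
      intro a b hab
      have h1 : simpleReflection M b (simpleRoot a) =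
          simpleRoot a + (2 * Real.cos (Real.pi / (M i j : ℝ))) • simpleRoot b := by
        rw [simpleReflection_apply, bilin_simpleRoot, hab]
        module
      rw [CoxeterSystem.alternatingWord_succ, CoxeterSystem.wordProd_concat, rho_mul_apply,
        rho_simple, h1, map_add, map_smul]
      nth_rewrite 1 [CoxeterSystem.alternatingWord_succ]
      rw [CoxeterSystem.wordProd_concat, rho_mul_apply, rho_simple,
        simpleReflection_simpleRoot_self, map_neg]
      abel
    rw [step i j rfl, step j i hM, ih1.1, ih1.2, ih2.1, ih2.2, hp (m + 1), hp m]
    simp only [he, ho]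
    by_cases hev : Even m <;> simp only [hev, if_true, if_false, not_true, not_false_eq_true] <;>
      constructor <;> module

theorem eq_alternatingWord_of_isReduced {i j : I} {a : List I} (ha : ∀ k ∈ a, k = i ∨ k = j)
    (hr : cs.IsReduced (a ++ [i])) : a = CoxeterSystem.alternatingWord i j a.length := by
  induction a using List.reverseRecOn generalizing i j with
  | nil => rfl
  | append_singleton a k ih =>
    have hk : k = j := by
      refine (ha k (by simp)).resolve_left ?_
      rintro rfl
      have h1 : cs.wordProd (a ++ [k] ++ [k]) = cs.wordProd a := by
        simp [CoxeterSystem.wordProd_append, CoxeterSystem.wordProd_cons]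
      have h2 := cs.length_wordProd_le a
      have h3 := hr.eq
      rw [h1] at h3
      simp at h3
      omega
    subst hk
    have hr' : cs.IsReduced (a ++ [k]) := by
      have := hr.take (a.length + 1)
      rwa [List.take_left' (by simp)] at this
    have := ih (i := k) (j := i) (fun l hl => (ha l (by simp [hl])).symm) hr'
    rw [List.length_append, List.length_singleton, CoxeterSystem.alternatingWord_succ, ← this]
    simp

/-- Every element is a product of an element without right descents in `{i, j}` and a word in
`i, j`, with lengths adding up. -/
theorem exists_dihedral_decomposition (i j : I) (w : W) :
    ∃ (v : W) (a : List I), w = v * cs.wordProd a ∧ cs.length v + a.length = cs.length w ∧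
      (∀ k ∈ a, k = i ∨ k = j) ∧ ¬ cs.IsRightDescent v i ∧ ¬ cs.IsRightDescent v j := by
  induction hn : cs.length w using Nat.strong_induction_on generalizing w with
  | _ n ih =>
    by_cases h : ∃ k, (k = i ∨ k = j) ∧ cs.IsRightDescent w k
    · obtain ⟨k, hk, hd⟩ := h
      have hl := cs.isRightDescent_iff.mp hd
      obtain ⟨v, a, hv, hva, ha, hi, hj⟩ := ih _ (by omega) (w * cs.simple k) rfl
      refine ⟨v, a ++ [k], ?_, by simp; omega, ?_, hi, hj⟩
      · rw [CoxeterSystem.wordProd_append, ← mul_assoc, ← hv]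
        simp
      · intro l hl
        rcases List.mem_append.mp hl with h | h
        · exact ha l h
        · rw [List.mem_singleton.mp h]
          exact hk
    · push Not at h
      exact ⟨w, [], by simp, by simp [hn], by simp, h i (Or.inl rfl), h j (Or.inr rfl)⟩

/-- If `ℓ(w s_i) > ℓ(w)`, then `w α_i` is a nonnegative combination of simple roots. -/
theorem rho_simpleRoot_nonneg (w : W) (i : I) (h : ¬ cs.IsRightDescent w i) :
    0 ≤ rho cs w (simpleRoot i) := by
  induction hn : cs.length w using Nat.strong_induction_on generalizing w i with
  | _ n ih =>
    have hpos : ∀ k : I, (0 : I →₀ ℝ) ≤ simpleRoot k := fun k => by simp [simpleRoot]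
    by_cases hw : w = 1
    · rw [hw, rho_one_apply]
      exact hpos i
    obtain ⟨j, hj⟩ := cs.exists_rightDescent_of_ne_one hw
    have hij : i ≠ j := by
      rintro rfl
      exact h hj
    obtain ⟨v, a, hv, hva, ha, hvi, hvj⟩ := exists_dihedral_decomposition cs i j w
    have hl := cs.not_isRightDescent_iff.mp h
    have hred : cs.IsReduced (a ++ [i]) := by
      have h1 : w * cs.simple i = v * cs.wordProd (a ++ [i]) := by
        rw [CoxeterSystem.wordProd_append, ← mul_assoc, ← hv]
        simp
      have h2 := cs.length_mul_le v (cs.wordProd (a ++ [i]))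
      have h3 := cs.length_wordProd_le (a ++ [i])
      rw [← h1] at h2
      simp only [List.length_append, List.length_singleton] at h3
      rw [CoxeterSystem.IsReduced, List.length_append, List.length_singleton]
      omega
    have halt := eq_alternatingWord_of_isReduced cs ha hred
    have hlt : cs.length v < n := by
      rcases Nat.eq_zero_or_pos a.length with h0 | h0
      · rw [List.length_eq_zero_iff.mp h0] at hv
        simp only [CoxeterSystem.wordProd_nil, mul_one] at hv
        exact absurd (hv ▸ hj) hvj
      · omega
    have hbound : M i j = 0 ∨ a.length + 1 ≤ M i j := by
      by_contra! hcon
      refine cs.not_isReduced_alternatingWord j i (m := a.length + 1) ?_ ?_ ?_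
      · rw [M.symmetric j i]; exact hcon.1
      · rw [M.symmetric j i]; exact hcon.2
      · rw [CoxeterSystem.alternatingWord_succ, ← halt, List.concat_eq_append]
        exact hred
    obtain ⟨p, p0, p1, hp, hp'⟩ := exists_dihedral_coeff (M i j) (M.off_diagonal i j hij)
    have hroot := (rho_alternatingWord_simpleRoot cs i j p0 p1 hp a.length).1
    rw [← halt] at hroot
    rw [hv, rho_mul_apply, hroot, map_add, map_smul, map_smul]
    have hA : ∀ k, k = i ∨ k = j → 0 ≤ rho cs v (simpleRoot k) := by
      rintro k (rfl | rfl)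
      · exact ih _ hlt v k hvi rfl
      · exact ih _ hlt v k hvj rfl
    refine add_nonneg (smul_nonneg (hp' _ hbound) (hA _ ?_))
      (smul_nonneg (hp' _ (hbound.imp_right (by omega))) (hA _ ?_)) <;> split_ifs <;> simp

/-- If `ℓ(w s_i) < ℓ(w)`, then `w α_i` is a nonpositive combination of simple roots. -/
theorem rho_simpleRoot_nonpos (w : W) (i : I) (h : cs.IsRightDescent w i) :
    rho cs w (simpleRoot i) ≤ 0 := by
  have := rho_simpleRoot_nonneg cs (w * cs.simple i) i
    (cs.isRightDescent_iff_not_isRightDescent_mul.mp h)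
  rwa [rho_mul_apply, rho_simple, simpleReflection_simpleRoot_self, map_neg, neg_nonneg] at this

variable {cs}

theorem simpleRoot_mem_roots (i : I) : simpleRoot i ∈ roots cs :=
  ⟨1, i, by rw [rho_one_apply]⟩

theorem rho_mem_roots {β : I →₀ ℝ} (h : β ∈ roots cs) (w : W) : rho cs w β ∈ roots cs := by
  obtain ⟨v, i, rfl⟩ := h
  exact ⟨w * v, i, by rw [rho_mul_apply]⟩

theorem neg_mem_roots {β : I →₀ ℝ} (h : β ∈ roots cs) : -β ∈ roots cs := by
  obtain ⟨v, i, rfl⟩ := h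
  exact ⟨v * cs.simple i, i, by
    rw [rho_mul_apply, rho_simple, simpleReflection_simpleRoot_self, map_neg]⟩

theorem bilin_self_of_mem_roots {β : I →₀ ℝ} (h : β ∈ roots cs) : bilin M β β = 1 := by
  obtain ⟨v, i, rfl⟩ := h
  rw [bilin_rho, bilin_simpleRoot_self]

theorem ne_zero_of_mem_roots {β : I →₀ ℝ} (h : β ∈ roots cs) : β ≠ 0 := by
  rintro rfl
  simpa using bilin_self_of_mem_roots h

theorem mem_posRoots {β : I →₀ ℝ} : β ∈ posRoots cs ↔ β ∈ roots cs ∧ 0 ≤ β := Iff.rfl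

theorem mem_posRoots_or_neg_mem {β : I →₀ ℝ} (h : β ∈ roots cs) :
    β ∈ posRoots cs ∨ -β ∈ posRoots cs := by
  obtain ⟨v, i, rfl⟩ := id h
  by_cases hd : cs.IsRightDescent v i
  · exact Or.inr ⟨neg_mem_roots h, neg_nonneg.mpr (rho_simpleRoot_nonpos cs v i hd)⟩
  · exact Or.inl ⟨h, rho_simpleRoot_nonneg cs v i hd⟩

theorem neg_notMem_posRoots {β : I →₀ ℝ} (h : β ∈ posRoots cs) : -β ∉ posRoots cs := fun h' =>
  ne_zero_of_mem_roots h.1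
    (le_antisymm (neg_nonneg.mp (mem_posRoots.mp h').2) (mem_posRoots.mp h).2)

theorem simpleRoot_mem_posRoots (i : I) : simpleRoot i ∈ posRoots cs :=
  ⟨simpleRoot_mem_roots i, show (0 : I →₀ ℝ) ≤ simpleRoot i by simp [simpleRoot]⟩

theorem simpleReflection_mem_roots {β : I →₀ ℝ} (h : β ∈ roots cs) (j : I) :
    simpleReflection M j β ∈ roots cs := by
  rw [← rho_simple_apply cs]
  exact rho_mem_roots h _

/-- The simple reflection `s_j` permutes the positive roots other than `α_j`. -/
theorem simpleReflection_mem_posRoots {β : I →₀ ℝ} (h : β ∈ posRoots cs) {j : I}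
    (hne : β ≠ simpleRoot j) : simpleReflection M j β ∈ posRoots cs := by
  have hroot := simpleReflection_mem_roots h.1 j
  refine (mem_posRoots_or_neg_mem hroot).resolve_right fun hneg => hne ?_
  have hz : ∀ k, k ≠ j → β k = 0 := fun k hk => by
    have h1 := hneg.2 k
    rw [Finsupp.neg_apply, simpleReflection_apply_of_ne hk] at h1
    linarith [h.2 k]
  have hβ : β = β j • simpleRoot j := by
    ext k
    by_cases hk : k = j
    · simp [hk, simpleRoot]
    · simp [hz k hk, simpleRoot, Ne.symm hk]
  have h1 := bilin_self_of_mem_roots h.1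
  rw [hβ] at h1
  simp only [map_smul, LinearMap.smul_apply, smul_eq_mul, bilin_simpleRoot_self] at h1
  have h2 : β j = 1 := by nlinarith [h.2 j]
  rw [hβ, h2, one_smul]

/-- The exchange property in the geometric representation. -/
theorem exists_sublist_of_neg {j : I} {ω : List I}
    (h : -rho cs (cs.wordProd ω)⁻¹ (simpleRoot j) ∈ posRoots cs) :
    ∃ ω' : List I, ω'.Sublist ω ∧
      ∀ v, rho cs (cs.wordProd ω') v = simpleReflection M j (rho cs (cs.wordProd ω) v) := by
  -- The general statement reflects in an arbitrary positive root `β` in place of `α_j`.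
  suffices H : ∀ (ω : List I) (β : I →₀ ℝ), β ∈ posRoots cs →
      -rho cs (cs.wordProd ω)⁻¹ β ∈ posRoots cs → ∃ ω' : List I, ω'.Sublist ω ∧
      ∀ v, rho cs (cs.wordProd ω') v =
        rho cs (cs.wordProd ω) v - (2 * bilin M (rho cs (cs.wordProd ω) v) β) • β by
    obtain ⟨ω', h1, h2⟩ := H ω _ (simpleRoot_mem_posRoots j) h
    exact ⟨ω', h1, fun v => by rw [h2, simpleReflection_apply]⟩
  intro ω
  induction ω with
  | nil =>
    intro β hβ hneg
    simp only [CoxeterSystem.wordProd_nil, inv_one, rho_one_apply] at hneg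
    exact absurd hneg (neg_notMem_posRoots hβ)
  | cons k ω ih =>
    intro β hβ hneg
    by_cases hk : β = simpleRoot k
    · refine ⟨ω, List.sublist_cons_self _ _, fun v => ?_⟩
      rw [hk, ← simpleReflection_apply, CoxeterSystem.wordProd_cons, rho_mul_apply, rho_simple,
        simpleReflection_simpleReflection]
    · rw [CoxeterSystem.wordProd_cons, mul_inv_rev, CoxeterSystem.inv_simple, rho_mul_apply,
        rho_simple] at hneg
      obtain ⟨ω', h1, h2⟩ := ih _ (simpleReflection_mem_posRoots hβ hk) hneg
      refine ⟨k :: ω', h1.cons_cons k, fun v => ?_⟩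
      rw [CoxeterSystem.wordProd_cons, CoxeterSystem.wordProd_cons, rho_mul_apply, rho_mul_apply,
        rho_simple, h2, map_sub, map_smul, simpleReflection_simpleReflection]
      congr 3
      rw [← bilin_simpleReflection k, simpleReflection_simpleReflection]

end RootSystem

/-! ### The Euler form of a Coxeter word -/

section EulerForm

variable {I : Type*} (M : CoxeterMatrix I)

/-- The (nonsymmetric) Euler form attached to an ordering `ℓ` of the index set: the bilinear form
with `E(α_a, α_a) = 1`, with `E(α_a, α_b) = 2 B(α_a, α_b)` if `a` comes after `b` in `ℓ`, and with
`E(α_a, α_b) = 0` if `a` comes before `b`. It is encoded as a linear functional of the second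
argument; the first letter of `ℓ` is split off in the recursion. -/
noncomputable def eulerForm : List I → (I →₀ ℝ) → Module.Dual ℝ (I →₀ ℝ)
  | [], _ => 0
  | j :: ℓ, u => (u j + (ℓ.map fun a => u a * (2 * bilin M (simpleRoot a) (simpleRoot j))).sum) •
      Finsupp.lapply j + eulerForm ℓ u

variable {M}

theorem eulerForm_cons_apply (j : I) (ℓ : List I) (u v : I →₀ ℝ) :
    eulerForm M (j :: ℓ) u v =
      (u j + (ℓ.map fun a => u a * (2 * bilin M (simpleRoot a) (simpleRoot j))).sum) * v j +
        eulerForm M ℓ u v := by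
  simp [eulerForm]

theorem eulerForm_append_singleton_apply (ℓ : List I) (j : I) (u v : I →₀ ℝ) :
    eulerForm M (ℓ ++ [j]) u v = eulerForm M ℓ u v + u j * v j +
      u j * (ℓ.map fun a => v a * (2 * bilin M (simpleRoot a) (simpleRoot j))).sum := by
  induction ℓ with
  | nil => simp [eulerForm]
  | cons k ℓ ih =>
    rw [List.cons_append, eulerForm_cons_apply, eulerForm_cons_apply, ih]
    simp only [List.map_append, List.sum_append, List.map_cons, List.sum_cons, List.map_nil,
      List.sum_nil, bilin_comm (simpleRoot j) (simpleRoot k)]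
    ring

theorem eulerForm_congr {ℓ : List I} {u u' v v' : I →₀ ℝ} (hu : ∀ a ∈ ℓ, u a = u' a)
    (hv : ∀ a ∈ ℓ, v a = v' a) : eulerForm M ℓ u v = eulerForm M ℓ u' v' := by
  induction ℓ with
  | nil => simp [eulerForm]
  | cons k ℓ ih =>
    rw [List.forall_mem_cons] at hu hv
    rw [eulerForm_cons_apply, eulerForm_cons_apply, ih hu.2 hv.2, hu.1, hv.1]
    congr 4
    exact List.map_congr_left fun a ha => by rw [hu.2 a ha]

theorem eulerForm_zero_left (ℓ : List I) : eulerForm M ℓ 0 = 0 := by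
  induction ℓ with
  | nil => rfl
  | cons k ℓ ih => simp [eulerForm, ih]

theorem list_sum_smul_simpleRoot {ℓ : List I} (hnd : ℓ.Nodup) (hall : ∀ i, i ∈ ℓ)
    (u : I →₀ ℝ) : (ℓ.map fun a => u a • simpleRoot a).sum = u := by
  classical
  rw [← List.sum_toFinset _ hnd]
  ext k
  simp [Finsupp.finsetSum_apply, simpleRoot, Finsupp.single_apply, hall]

theorem list_sum_mul_bilin {j : I} {ℓ : List I} (hnd : (j :: ℓ).Nodup)
    (hall : ∀ i, i ∈ j :: ℓ) (u : I →₀ ℝ) :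
    (ℓ.map fun a => u a * (2 * bilin M (simpleRoot a) (simpleRoot j))).sum =
      2 * bilin M u (simpleRoot j) - 2 * u j := by
  have h : bilin M u (simpleRoot j) =
      ((j :: ℓ).map fun a => u a * bilin M (simpleRoot a) (simpleRoot j)).sum := by
    conv_lhs => rw [← list_sum_smul_simpleRoot hnd hall u]
    rw [← LinearMap.flip_apply, map_list_sum, List.map_map]
    congr 1
    exact List.map_congr_left fun a _ => by simp
  have h2 : (ℓ.map fun a => u a * (2 * bilin M (simpleRoot a) (simpleRoot j))).sum =
      2 * (ℓ.map fun a => u a * bilin M (simpleRoot a) (simpleRoot j)).sum := by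
    rw [← List.sum_map_mul_left]
    congr 1
    exact List.map_congr_left fun a _ => by ring
  rw [h2, h, List.map_cons, List.sum_cons, bilin_simpleRoot_self]
  ring

theorem simpleRoot_apply_of_mem {j : I} {ℓ : List I} (hj : j ∉ ℓ) :
    ∀ a ∈ ℓ, simpleRoot j a = (0 : I →₀ ℝ) a := by
  intro a ha
  have : a ≠ j := fun h => hj (h ▸ ha)
  simp [simpleRoot, this.symm]

theorem eulerForm_simpleRoot_head {j : I} {ℓ : List I} (hnd : (j :: ℓ).Nodup)
    (hall : ∀ i, i ∈ j :: ℓ) : eulerForm M (j :: ℓ) (simpleRoot j) = Finsupp.lapply j := by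
  refine LinearMap.ext fun v => ?_
  rw [eulerForm_cons_apply, list_sum_mul_bilin hnd hall, bilin_simpleRoot_self,
    eulerForm_congr (simpleRoot_apply_of_mem (List.nodup_cons.mp hnd).1) fun _ _ => rfl,
    eulerForm_zero_left]
  simp [simpleRoot]

theorem eulerForm_apply_simpleRoot_head {j : I} {ℓ : List I} (hnd : (j :: ℓ).Nodup)
    (hall : ∀ i, i ∈ j :: ℓ) (u : I →₀ ℝ) :
    eulerForm M (j :: ℓ) u (simpleRoot j) = -simpleReflection M j u j := by
  rw [eulerForm_cons_apply, list_sum_mul_bilin hnd hall, simpleReflection_apply_self,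
    eulerForm_congr (fun _ _ => rfl) (simpleRoot_apply_of_mem (List.nodup_cons.mp hnd).1), map_zero]
  simp [simpleRoot]
  ring

theorem eulerForm_simpleRoot_last {j : I} {ℓ : List I} (hnd : (j :: ℓ).Nodup)
    (hall : ∀ i, i ∈ j :: ℓ) (v : I →₀ ℝ) :
    eulerForm M (ℓ ++ [j]) (simpleRoot j) v = -simpleReflection M j v j := by
  rw [eulerForm_append_singleton_apply, list_sum_mul_bilin hnd hall, simpleReflection_apply_self,
    eulerForm_congr (simpleRoot_apply_of_mem (List.nodup_cons.mp hnd).1) fun _ _ => rfl,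
    eulerForm_zero_left]
  simp [simpleRoot]
  ring

/-- Reflecting in the first letter turns the Euler form of an ordering into the Euler form of the
rotated ordering. -/
theorem eulerForm_rotate {j : I} {ℓ : List I} (hnd : (j :: ℓ).Nodup) (hall : ∀ i, i ∈ j :: ℓ)
    (u v : I →₀ ℝ) :
    eulerForm M (ℓ ++ [j]) (simpleReflection M j u) (simpleReflection M j v) =
      eulerForm M (j :: ℓ) u v := by
  have hoff : ∀ w : I →₀ ℝ, ∀ a ∈ ℓ, simpleReflection M j w a = w a := fun w a ha =>
    simpleReflection_apply_of_ne (ne_of_mem_of_not_mem ha (List.nodup_cons.mp hnd).1) w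
  have hS : ((ℓ.map fun a => simpleReflection M j v a *
        (2 * bilin M (simpleRoot a) (simpleRoot j))).sum) =
      (ℓ.map fun a => v a * (2 * bilin M (simpleRoot a) (simpleRoot j))).sum := by
    congr 1
    exact List.map_congr_left fun a ha => by rw [hoff v a ha]
  rw [eulerForm_append_singleton_apply, eulerForm_cons_apply, hS,
    eulerForm_congr (hoff u) (hoff v), simpleReflection_apply_self, simpleReflection_apply_self,
    list_sum_mul_bilin hnd hall, list_sum_mul_bilin hnd hall]
  ring

end EulerForm

/-! ### Convex sets and toggles -/

section Toggle

variable {I W : Type*} [Group W] {M : CoxeterMatrix I} {cs : CoxeterSystem M W} {L : Set W}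

theorem neg_notMem_rootsOf (hL : L.Nonempty) {β : I →₀ ℝ} (h : β ∈ rootsOf cs L) :
    -β ∉ rootsOf cs L := by
  obtain ⟨z, hz⟩ := hL
  intro h'
  have h1 : rho cs z (-β) ∈ posRoots cs := h'.2 hz
  rw [map_neg] at h1
  exact neg_notMem_posRoots (h.2 hz) h1

/-- `R(L)` contains every root that is a nonnegative combination of two of its elements. -/
theorem add_smul_mem_rootsOf {β δ : I →₀ ℝ} (hβ : β ∈ rootsOf cs L) (hδ : δ ∈ rootsOf cs L)
    {a : ℝ} (ha : 0 ≤ a) (h : β + a • δ ∈ roots cs) : β + a • δ ∈ rootsOf cs L := by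
  refine ⟨h, fun z hz => ⟨rho_mem_roots h z, ?_⟩⟩
  change (0 : I →₀ ℝ) ≤ rho cs z (β + a • δ)
  rw [map_add, map_smul]
  exact add_nonneg (mem_posRoots.mp (hβ.2 hz)).2 (smul_nonneg ha (mem_posRoots.mp (hδ.2 hz)).2)

theorem mem_of_isConvex (hL : IsConvex cs L) {w : W}
    (h : ∀ β ∈ rootsOf cs L, rho cs w β ∈ posRoots cs) : w ∈ L := by
  rw [← hL]
  exact Set.mem_iInter₂.mpr h

theorem toggle_mem (hL : IsConvex cs L) (i : I) {u : W} (hu : u ∈ L) : toggle cs L i u ∈ L := by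
  by_cases h : rho cs u⁻¹ (simpleRoot i) ∈ rootsOf cs L
  · rwa [toggle, if_pos h]
  · rw [toggle, if_neg h]
    refine mem_of_isConvex hL fun β hβ => ?_
    rw [rho_mul_apply, rho_simple]
    refine simpleReflection_mem_posRoots (hβ.2 hu) fun hi => h ?_
    rwa [← hi, rho_inv_apply_apply]

theorem toggle_toggle_of_mem (i : I) {u : W} (hu : u ∈ L) :
    toggle cs L i (toggle cs L i u) = u := by
  by_cases h : rho cs u⁻¹ (simpleRoot i) ∈ rootsOf cs L
  · rw [toggle, toggle, if_pos h, if_pos h]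
  · have h2 : toggle cs L i u = cs.simple i * u := by rw [toggle, if_neg h]
    rw [h2, toggle, if_neg, cs.simple_mul_simple_cancel_left]
    intro h3
    rw [mul_inv_rev, CoxeterSystem.inv_simple, rho_mul_apply, rho_simple,
      simpleReflection_simpleRoot_self] at h3
    have h4 : rho cs u (rho cs u⁻¹ (-simpleRoot i)) ∈ posRoots cs := h3.2 hu
    rw [rho_apply_inv_apply] at h4
    exact neg_notMem_posRoots (simpleRoot_mem_posRoots i) h4

theorem toggleWord_image (hL : IsConvex cs L) (Q : List I) : toggleWord cs L Q '' L = L := by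
  induction Q with
  | nil => simp [toggleWord]
  | cons i Q ih =>
    rw [toggleWord, Set.image_comp, ih]
    refine Set.Subset.antisymm ?_ fun u hu => ?_
    · rintro _ ⟨u, hu, rfl⟩
      exact toggle_mem hL i hu
    · exact ⟨_, toggle_mem hL i hu, toggle_toggle_of_mem i hu⟩

theorem toggleWord_append (Q Q' : List I) :
    toggleWord cs L (Q ++ Q') = toggleWord cs L Q ∘ toggleWord cs L Q' := by
  induction Q with
  | nil => rfl
  | cons i Q ih => rw [List.cons_append, toggleWord, ih, toggleWord, Function.comp_assoc]

theorem toggleWord_flatten_replicate (c : List I) (k : ℕ) :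
    toggleWord cs L (List.replicate k c).flatten = (toggleWord cs L c)^[k] := by
  induction k with
  | zero => rfl
  | succ k ih =>
    rw [List.replicate_succ, List.flatten_cons, toggleWord_append, ih, Function.iterate_succ']

end Toggle

/-! ### Tracing a wall backwards through the toggles -/

section Trace

variable {I : Type*}

/-- The first `N` letters of the periodic word `ℓ ℓ ℓ ⋯`. -/
def periodicWord : ℕ → List I → List I
  | 0, _ => []
  | _ + 1, [] => []
  | N + 1, j :: ℓ => j :: periodicWord N (ℓ ++ [j])

theorem periodicWord_append (ℓ ℓ' : List I) (N : ℕ) :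
    periodicWord (ℓ.length + N) (ℓ ++ ℓ') = ℓ ++ periodicWord N (ℓ' ++ ℓ) := by
  induction ℓ generalizing ℓ' with
  | nil => simp
  | cons j ℓ ih =>
    rw [List.length_cons, Nat.add_right_comm, List.cons_append, periodicWord, List.append_assoc, ih]
    simp

theorem flatten_replicate_eq_periodicWord (c : List I) (k : ℕ) :
    (List.replicate k c).flatten = periodicWord (k * c.length) c := by
  induction k with
  | zero => simp [periodicWord]
  | succ k ih =>
    have := periodicWord_append c [] (k * c.length)
    rw [List.append_nil, List.nil_append] at this
    rw [List.replicate_succ, List.flatten_cons, ih, add_mul, one_mul, add_comm, this]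

variable {W : Type*} [Group W] {M : CoxeterMatrix I} (cs : CoxeterSystem M W)

/-- The linear functionals met when the coordinate functional of `α_i` is carried along the letters
of a periodic word: up to the first letter `i` it remains the coordinate functional, and from then
on it is represented by a root `η` through the Euler form. -/
def IsTraced (ℓ : List I) (f : Module.Dual ℝ (I →₀ ℝ)) : Prop :=
  (∃ i, f = Finsupp.lapply i) ∨ ∃ η ∈ posRoots cs, f = -eulerForm M ℓ η

variable {cs}

/-- As long as the root representing a traced functional has not become the simple root of the
current letter (in which case the functional is minus a coordinate functional), the functional is
nonnegative on that simple root and its reflection is traced again. -/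
theorem IsTraced.rotate {j : I} {ℓ : List I} (hnd : (j :: ℓ).Nodup) (hall : ∀ i, i ∈ j :: ℓ)
    {f : Module.Dual ℝ (I →₀ ℝ)} (hf : IsTraced cs (j :: ℓ) f) :
    f = -Finsupp.lapply j ∨ (0 ≤ f (simpleRoot j) ∧
      IsTraced cs (ℓ ++ [j]) (f ∘ₗ (simpleReflection M j : (I →₀ ℝ) →ₗ[ℝ] (I →₀ ℝ)))) := by
  rcases hf with ⟨i, rfl⟩ | ⟨η, hη, rfl⟩
  · right
    refine ⟨(simpleRoot_mem_posRoots (cs := cs) j).2 i, ?_⟩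
    by_cases hij : i = j
    · subst hij
      refine Or.inr ⟨simpleRoot i, simpleRoot_mem_posRoots i, LinearMap.ext fun v => ?_⟩
      rw [LinearMap.neg_apply, eulerForm_simpleRoot_last hnd hall]
      simp
    · exact Or.inl ⟨i, LinearMap.ext fun v => simpleReflection_apply_of_ne hij v⟩
  · by_cases hj : η = simpleRoot j
    · left
      rw [hj, eulerForm_simpleRoot_head hnd hall]
    · right
      have hη' := simpleReflection_mem_posRoots hη hj
      refine ⟨?_, Or.inr ⟨_, hη', LinearMap.ext fun v => ?_⟩⟩
      · rw [LinearMap.neg_apply, eulerForm_apply_simpleRoot_head hnd hall, neg_neg]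
        exact hη'.2 j
      · have := eulerForm_rotate (M := M) hnd hall η (simpleReflection M j v)
        rw [simpleReflection_simpleReflection] at this
        simpa using this.symm

theorem apply_nonpos_of_nonneg {f : Module.Dual ℝ (I →₀ ℝ)} (hf : ∀ l, f (simpleRoot l) ≤ 0)
    {γ : I →₀ ℝ} (hγ : 0 ≤ γ) : f γ ≤ 0 := by
  rw [← Finsupp.sum_single γ, Finsupp.sum, map_sum]
  refine Finset.sum_nonpos fun l _ => ?_
  have h : Finsupp.single l (γ l) = γ l • simpleRoot l := by simp [simpleRoot]
  rw [h, map_smul, smul_eq_mul]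
  exact mul_nonpos_of_nonneg_of_nonpos (hγ l) (hf l)

/-- A subword `ω` of the word that remains and carries `f` into the antidominant chamber can be
adapted when the first letter of the word is processed. -/
theorem exists_sublist_antidominant {j : I} {Q ω : List I} (hω : ω.Sublist (j :: Q))
    {f : Module.Dual ℝ (I →₀ ℝ)} (hfj : 0 ≤ f (simpleRoot j))
    (hf : ∀ l, f (rho cs (cs.wordProd ω) (simpleRoot l)) ≤ 0) :
    ∃ ω' : List I, ω'.Sublist Q ∧
      ∀ l, f (simpleReflection M j (rho cs (cs.wordProd ω') (simpleRoot l))) ≤ 0 := by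
  cases hω with
  | cons_cons _ h =>
    rename_i ω'
    refine ⟨ω', h, fun l => ?_⟩
    rw [← rho_simple_apply cs, ← rho_mul_apply, ← CoxeterSystem.wordProd_cons]
    exact hf l
  | cons _ h =>
    have hroot : rho cs (cs.wordProd ω)⁻¹ (simpleRoot j) ∈ roots cs :=
      rho_mem_roots (simpleRoot_mem_roots j) _
    rcases mem_posRoots_or_neg_mem hroot with hp | hn
    -- Here `f (α_j)` must vanish, so `f` agrees with its reflection and `ω` can be kept.
    · have h0 : f (simpleRoot j) ≤ 0 := by
        have := apply_nonpos_of_nonneg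
          (f := f ∘ₗ (rho cs (cs.wordProd ω) : (I →₀ ℝ) →ₗ[ℝ] (I →₀ ℝ))) hf (mem_posRoots.mp hp).2
        rwa [LinearMap.comp_apply, LinearEquiv.coe_coe, rho_apply_inv_apply] at this
      refine ⟨ω, h, fun l => ?_⟩
      rw [simpleReflection_apply, map_sub, map_smul, le_antisymm h0 hfj, smul_zero, sub_zero]
      exact hf l
    -- Here `j` is a left descent of `ω`, and a letter of `ω` can be erased.
    · obtain ⟨ω', h1, h2⟩ := exists_sublist_of_neg hn
      refine ⟨ω', h1.trans h, fun l => ?_⟩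
      rw [h2, simpleReflection_simpleReflection]
      exact hf l

variable {L : Set W}

/-- If the wall of a root in `R(L)` is met from the wrong side after a toggle, it can be replaced by
such a wall before the toggle, in such a way that the value of the reflected functional does not
decrease. -/
theorem exists_wall_before_toggle (hL : L.Nonempty) (j : I) (w : W) {γ : I →₀ ℝ}
    (hγ : γ ∈ posRoots cs) (hw : rho cs (toggle cs L j w)⁻¹ (-γ) ∈ rootsOf cs L)
    {f : Module.Dual ℝ (I →₀ ℝ)} (hfj : 0 ≤ f (simpleRoot j)) :
    ∃ γ' ∈ posRoots cs, rho cs w⁻¹ (-γ') ∈ rootsOf cs L ∧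
      f γ ≤ f (simpleReflection M j γ') := by
  by_cases h : rho cs w⁻¹ (simpleRoot j) ∈ rootsOf cs L
  · rw [toggle, if_pos h] at hw
    rcases le_total (bilin M γ (simpleRoot j)) 0 with hb | hb
    · refine ⟨γ, hγ, hw, ?_⟩
      rw [simpleReflection_apply, map_sub, map_smul, smul_eq_mul]
      nlinarith
    · have hne : γ ≠ simpleRoot j := by
        rintro rfl
        rw [map_neg] at hw
        exact neg_notMem_rootsOf hL h hw
      have hγ' := simpleReflection_mem_posRoots hγ hne
      refine ⟨_, hγ', ?_, by rw [simpleReflection_simpleReflection]⟩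
      have heq : rho cs w⁻¹ (-simpleReflection M j γ) = rho cs w⁻¹ (-γ) +
          (2 * bilin M γ (simpleRoot j)) • rho cs w⁻¹ (simpleRoot j) := by
        rw [← map_smul, ← map_add, simpleReflection_apply]
        congr 1
        module
      have hr := rho_mem_roots (neg_mem_roots hγ'.1) w⁻¹
      rw [heq] at hr ⊢
      exact add_smul_mem_rootsOf hw h (by positivity) hr
  · rw [toggle, if_neg h, mul_inv_rev, CoxeterSystem.inv_simple, rho_mul_apply, rho_simple,
      map_neg] at hw
    have hne : γ ≠ simpleRoot j := by
      rintro rfl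
      rw [simpleReflection_simpleRoot_self, neg_neg] at hw
      exact h hw
    exact ⟨_, simpleReflection_mem_posRoots hγ hne, hw,
      by rw [simpleReflection_simpleReflection]⟩

/-- Induction over the letters of the word, read from the last toggle to the first: a traced
functional is nonpositive on every positive root `γ` whose wall separates the outcome of the toggles
from `L`. -/
theorem trace_nonpos (hL : L.Nonempty) (N : ℕ) (u : W) {ℓ : List I} (hnd : ℓ.Nodup)
    (hall : ∀ i, i ∈ ℓ) {f : Module.Dual ℝ (I →₀ ℝ)} (hf : IsTraced cs ℓ f) {ω : List I}
    (hω : ω.Sublist (periodicWord N ℓ))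
    (hfω : ∀ l, f (rho cs (cs.wordProd ω) (simpleRoot l)) ≤ 0) {γ : I →₀ ℝ}
    (hγ : γ ∈ posRoots cs)
    (hw : rho cs (toggleWord cs L (periodicWord N ℓ) u)⁻¹ (-γ) ∈ rootsOf cs L) : f γ ≤ 0 := by
  induction N generalizing ℓ f ω γ with
  | zero =>
    rw [periodicWord, List.sublist_nil] at hω
    subst hω
    simp only [CoxeterSystem.wordProd_nil, rho_one_apply] at hfω
    exact apply_nonpos_of_nonneg hfω (mem_posRoots.mp hγ).2
  | succ N ih =>
    cases ℓ with
    | nil =>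
      rw [periodicWord, List.sublist_nil] at hω
      subst hω
      simp only [CoxeterSystem.wordProd_nil, rho_one_apply] at hfω
      exact apply_nonpos_of_nonneg hfω (mem_posRoots.mp hγ).2
    | cons j ℓ =>
      rcases hf.rotate hnd hall with rfl | ⟨hfj, hf'⟩
      · exact neg_nonpos.mpr (hγ.2 j)
      · obtain ⟨ω', hω', hfω'⟩ := exists_sublist_antidominant hω hfj hfω
        obtain ⟨γ', hγ', hw', hle⟩ := exists_wall_before_toggle hL j _ hγ hw hfj
        have hperm : (ℓ ++ [j]).Perm (j :: ℓ) := List.perm_append_singleton j ℓ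
        exact hle.trans (ih (hperm.nodup_iff.mpr hnd) (fun i => hperm.mem_iff.mpr (hall i)) hf'
          hω' hfω' hγ' hw')

/-- If `k` copies of an ordering `c` of the index set contain a word for an element that makes all
simple roots negative, then `k` rounds of toggles along `c` map `W` onto a nonempty convex set. -/
theorem iterate_toggleWord_image_univ (hL : L.Nonempty) (hconv : IsConvex cs L) {c : List I}
    (hnd : c.Nodup) (hall : ∀ i, i ∈ c) {k : ℕ} {ω : List I}
    (hω : ω.Sublist (List.replicate k c).flatten)
    (hneg : ∀ l, rho cs (cs.wordProd ω) (simpleRoot l) ≤ 0) :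
    (toggleWord cs L c)^[k] '' Set.univ = L := by
  rw [← toggleWord_flatten_replicate]
  refine Set.Subset.antisymm ?_ ?_
  · rintro _ ⟨u, -, rfl⟩
    rw [flatten_replicate_eq_periodicWord] at hω ⊢
    refine mem_of_isConvex hconv fun β hβ => ?_
    refine (mem_posRoots_or_neg_mem (rho_mem_roots hβ.1 _)).resolve_right fun hγ => ?_
    refine ne_zero_of_mem_roots hγ.1 (le_antisymm (fun i => ?_) (mem_posRoots.mp hγ).2)
    refine trace_nonpos hL (k * c.length) u hnd hall (Or.inl ⟨i, rfl⟩) hω (fun l => hneg l i) hγ ?_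
    rwa [neg_neg, rho_inv_apply_apply]
  · conv_lhs => rw [← toggleWord_image hconv (List.replicate k c).flatten]
    exact Set.image_mono (Set.subset_univ _)

theorem IsLongElement.rho_simpleRoot_nonpos {w : W} (h : IsLongElement cs w) (l : I) :
    rho cs w (simpleRoot l) ≤ 0 :=
  BenderKnuth.rho_simpleRoot_nonpos cs w l
    (lt_of_le_of_ne (h _) (cs.length_mul_simple_ne w l))

theorem sublist_flatten_replicate {c : List I} (hall : ∀ i, i ∈ c) (ω : List I) :
    ω.Sublist (List.replicate ω.length c).flatten := by
  induction ω with
  | nil => simp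
  | cons i ω ih =>
    rw [List.length_cons, List.replicate_succ, List.flatten_cons]
    exact (List.singleton_sublist.mpr (hall i)).append ih

theorem exists_isReduced_sublist_minPower [Finite W] {c : List I} (hall : ∀ i, i ∈ c) :
    ∃ ω : List I, ω.Sublist (List.replicate (minPower cs c) c).flatten ∧
      cs.IsReduced ω ∧ IsLongElement cs (cs.wordProd ω) := by
  refine (Nat.sInf_mem (s := {k | 0 < k ∧ ∃ w : List I, w.Sublist (List.replicate k c).flatten ∧
    cs.IsReduced w ∧ IsLongElement cs (cs.wordProd w)}) ?_).2
  obtain ⟨w, hw⟩ := Finite.exists_max cs.length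
  obtain ⟨ω, hr, rfl⟩ := cs.exists_isReduced w
  refine ⟨ω.length + 1, Nat.succ_pos _, ω, ?_, hr, hw⟩
  rw [List.replicate_succ, List.flatten_cons]
  exact (sublist_flatten_replicate hall ω).trans (List.sublist_append_right _ _)

end Trace

/-! ### The symmetric group as the Coxeter group of type `A` -/

section TypeA

variable {n : ℕ}

/-- The adjacent transposition exchanging `i` and `i + 1`. -/
def adjSwap (i : Fin n) : Equiv.Perm (Fin (n + 1)) := Equiv.swap i.castSucc i.succ

theorem adjSwap_apply_castSucc (i : Fin n) : adjSwap i i.castSucc = i.succ :=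
  Equiv.swap_apply_left _ _

theorem adjSwap_apply_succ (i : Fin n) : adjSwap i i.succ = i.castSucc :=
  Equiv.swap_apply_right _ _

theorem adjSwap_apply_of_ne {i : Fin n} {x : Fin (n + 1)} (h1 : (x : ℕ) ≠ i)
    (h2 : (x : ℕ) ≠ i + 1) : adjSwap i x = x :=
  Equiv.swap_apply_of_ne_of_ne (fun h => h1 (by simp [h])) (fun h => h2 (by simp [h]))

theorem adjSwap_apply_val (i : Fin n) (x : Fin (n + 1)) :
    (adjSwap i x : ℕ) =
      if (x : ℕ) = i then (i : ℕ) + 1 else if (x : ℕ) = i + 1 then (i : ℕ) else x := by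
  split_ifs with h1 h2
  · rw [show x = i.castSucc from Fin.ext h1, adjSwap_apply_castSucc, Fin.val_succ]
  · rw [show x = i.succ from Fin.ext h2, adjSwap_apply_succ, Fin.val_castSucc]
  · rw [adjSwap_apply_of_ne h1 h2]

theorem isLiftable_adjSwap : (CoxeterMatrix.A n).IsLiftable (adjSwap (n := n)) := by
  intro i j
  have hM : CoxeterMatrix.A n i j = if i = j then 1 else
    (if (j : ℕ) + 1 = i ∨ (i : ℕ) + 1 = j then 3 else 2) := rfl
  rw [hM]
  ext x
  split_ifs with h1 h2
  · simp [adjSwap, h1]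
  · simp only [pow_succ, pow_zero, one_mul, Equiv.Perm.mul_apply, adjSwap_apply_val,
      Equiv.Perm.one_apply]
    rcases h2 with h2 | h2 <;> grind
  · have h3 : (i : ℕ) ≠ j := fun h => h1 (Fin.ext h)
    simp only [pow_succ, pow_zero, one_mul, Equiv.Perm.mul_apply, adjSwap_apply_val,
      Equiv.Perm.one_apply]
    grind

/-- The embedding of the root space of type `A_n` into `ℝ^{n+1}` with `α_i ↦ e_i - e_{i+1}`. -/
noncomputable def typeAEmbedding : (Fin n →₀ ℝ) →ₗ[ℝ] (Fin (n + 1) →₀ ℝ) :=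
  Finsupp.linearCombination ℝ fun i => Finsupp.single i.castSucc 1 - Finsupp.single i.succ 1

theorem typeAEmbedding_simpleRoot (i : Fin n) :
    typeAEmbedding (simpleRoot i) = Finsupp.single i.castSucc 1 - Finsupp.single i.succ 1 := by
  simp [typeAEmbedding, simpleRoot]

/-- The coordinate at `α_i` is a partial sum of the coordinates in `ℝ^{n+1}`. -/
theorem apply_eq_sum_typeAEmbedding (β : Fin n →₀ ℝ) (i : Fin n) :
    β i = ∑ b ∈ Finset.Iic i.castSucc, typeAEmbedding β b := by
  have h : (Finsupp.lapply i : (Fin n →₀ ℝ) →ₗ[ℝ] ℝ) =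
      (∑ b ∈ Finset.Iic i.castSucc, Finsupp.lapply b) ∘ₗ typeAEmbedding := by
    refine Finsupp.lhom_ext' fun j => LinearMap.ext_ring ?_
    have := typeAEmbedding_simpleRoot j
    rw [simpleRoot] at this
    simp only [LinearMap.comp_apply, LinearMap.sum_apply, Finsupp.lsingle_apply, this,
      Finsupp.lapply_apply, Finsupp.sub_apply, Finset.sum_sub_distrib, Finsupp.single_apply,
      Finset.sum_ite_eq, Finset.mem_Iic]
    simp only [Fin.le_def, Fin.val_castSucc, Fin.val_succ, Fin.ext_iff]
    split_ifs <;> first | omega | simp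
  simpa using congrArg (fun F => F β) h

theorem typeAEmbedding_injective : Function.Injective (typeAEmbedding (n := n)) := by
  intro β γ h
  ext i
  rw [apply_eq_sum_typeAEmbedding, h, ← apply_eq_sum_typeAEmbedding]

theorem two_mul_bilin_typeA (i j : Fin n) :
    2 * bilin (CoxeterMatrix.A n) (simpleRoot j) (simpleRoot i) =
      if j = i then 2 else if (i : ℕ) + 1 = j ∨ (j : ℕ) + 1 = i then -1 else 0 := by
  have hM : CoxeterMatrix.A n j i = if j = i then 1 else
    (if (i : ℕ) + 1 = j ∨ (j : ℕ) + 1 = i then 3 else 2) := rfl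
  rw [bilin_simpleRoot, hM]
  split_ifs <;> norm_num

theorem mapDomain_single_sub_single {α β : Type*} (f : α → β) (a b : α) :
    Finsupp.mapDomain f (Finsupp.single a (1 : ℝ) - Finsupp.single b 1) =
      Finsupp.single (f a) 1 - Finsupp.single (f b) 1 := by
  rw [← Finsupp.mapDomain_single, ← Finsupp.mapDomain_single (a := b)]
  exact (Finsupp.lmapDomain ℝ ℝ f).map_sub _ _

theorem typeAEmbedding_simpleReflection (i : Fin n) (β : Fin n →₀ ℝ) :
    typeAEmbedding (simpleReflection (CoxeterMatrix.A n) i β) =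
      Finsupp.mapDomain (adjSwap i) (typeAEmbedding β) := by
  have h : typeAEmbedding ∘ₗ (simpleReflection (CoxeterMatrix.A n) i :
        (Fin n →₀ ℝ) →ₗ[ℝ] (Fin n →₀ ℝ)) =
      Finsupp.lmapDomain ℝ ℝ (adjSwap i) ∘ₗ typeAEmbedding := by
    refine Finsupp.lhom_ext' fun j => LinearMap.ext_ring ?_
    change typeAEmbedding (simpleReflection (CoxeterMatrix.A n) i (simpleRoot j)) =
      Finsupp.mapDomain (adjSwap i) (typeAEmbedding (simpleRoot j))
    rw [simpleReflection_apply, two_mul_bilin_typeA, map_sub, map_smul, typeAEmbedding_simpleRoot,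
      typeAEmbedding_simpleRoot, mapDomain_single_sub_single]
    split_ifs with h1 h2
    · subst h1
      rw [adjSwap_apply_castSucc, adjSwap_apply_succ]
      module
    · rcases h2 with h2 | h2
      · have e : j.castSucc = i.succ := Fin.ext (by simp [h2])
        rw [e, adjSwap_apply_succ, adjSwap_apply_of_ne (by simp; omega) (by simp; omega)]
        module
      · have e : j.succ = i.castSucc := Fin.ext (by simp [h2])
        rw [e, adjSwap_apply_castSucc, adjSwap_apply_of_ne (by simp; omega) (by simp; omega)]
        module
    · have h3 : (j : ℕ) ≠ i := fun h => h1 (Fin.ext h)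
      rw [adjSwap_apply_of_ne (by simp; omega) (by simp; omega),
        adjSwap_apply_of_ne (by simp; omega) (by simp; omega)]
      module
  exact congrArg (fun F => F β) h

theorem typeAEmbedding_rho_of_hom {W : Type*} [Group W] (cs : CoxeterSystem (CoxeterMatrix.A n) W)
    (φ : W →* Equiv.Perm (Fin (n + 1))) (hφ : ∀ i, φ (cs.simple i) = adjSwap i) (w : W)
    (β : Fin n →₀ ℝ) :
    typeAEmbedding (rho cs w β) = Finsupp.mapDomain (φ w) (typeAEmbedding β) := by
  induction w using cs.simple_induction_left with
  | one =>
    rw [rho_one_apply, map_one, Equiv.Perm.coe_one, Finsupp.mapDomain_id]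
  | mul_simple_left w i h =>
    rw [rho_mul_apply, rho_simple, typeAEmbedding_simpleReflection, h, map_mul, hφ,
      Equiv.Perm.coe_mul, Finsupp.mapDomain_comp]

/-- The homomorphism from the abstract Coxeter group of type `A_n` to the symmetric group. -/
noncomputable def typeAHom (n : ℕ) :
    (CoxeterMatrix.A n).Group →* Equiv.Perm (Fin (n + 1)) :=
  (CoxeterMatrix.A n).toCoxeterSystem.lift ⟨adjSwap, isLiftable_adjSwap⟩

theorem typeAHom_simple (i : Fin n) :
    typeAHom n ((CoxeterMatrix.A n).toCoxeterSystem.simple i) = adjSwap i :=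
  CoxeterSystem.lift_apply_simple _ isLiftable_adjSwap i

/-- An element acting trivially on `ℝ^{n+1}` makes no simple root negative, so it has length `0`. -/
theorem typeAHom_injective : Function.Injective (typeAHom n) := by
  rw [injective_iff_map_eq_one]
  intro w hw
  by_contra hne
  obtain ⟨i, hi⟩ := (CoxeterMatrix.A n).toCoxeterSystem.exists_rightDescent_of_ne_one hne
  have h1 := rho_simpleRoot_nonpos _ w i hi
  have h2 := typeAEmbedding_rho_of_hom _ (typeAHom n) typeAHom_simple w (simpleRoot i)
  rw [hw, Equiv.Perm.coe_one, Finsupp.mapDomain_id] at h2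
  rw [typeAEmbedding_injective h2] at h1
  have h3 := h1 i
  simp [simpleRoot] at h3
  linarith

theorem typeAHom_surjective : Function.Surjective (typeAHom n) := by
  rw [← MonoidHom.mrange_eq_top, eq_top_iff, ← Equiv.Perm.mclosure_swap_castSucc_succ,
    Submonoid.closure_le]
  rintro _ ⟨i, rfl⟩
  exact ⟨_, typeAHom_simple i⟩

/-- The symmetric group on `n + 1` letters as a Coxeter group of type `A_n`, generated by the
adjacent transpositions. -/
noncomputable def permCoxeterSystem (n : ℕ) :
    CoxeterSystem (CoxeterMatrix.A n) (Equiv.Perm (Fin (n + 1))) :=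
  (CoxeterMatrix.A n).toCoxeterSystem.map
    (MulEquiv.ofBijective (typeAHom n) ⟨typeAHom_injective, typeAHom_surjective⟩)

theorem permCoxeterSystem_simple (i : Fin n) : (permCoxeterSystem n).simple i = adjSwap i :=
  typeAHom_simple i

/-- The permutation `w` sends the root `e_a - e_b` to `e_{w a} - e_{w b}`. -/
theorem typeAEmbedding_rho (w : Equiv.Perm (Fin (n + 1))) {β : Fin n →₀ ℝ} {a b : Fin (n + 1)}
    (h : typeAEmbedding β = Finsupp.single a 1 - Finsupp.single b 1) :
    typeAEmbedding (rho (permCoxeterSystem n) w β) =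
      Finsupp.single (w a) 1 - Finsupp.single (w b) 1 := by
  rw [typeAEmbedding_rho_of_hom _ (MonoidHom.id _) permCoxeterSystem_simple, h, MonoidHom.id_apply,
    mapDomain_single_sub_single]

theorem nonneg_iff_of_typeAEmbedding {β : Fin n →₀ ℝ} {a b : Fin (n + 1)}
    (h : typeAEmbedding β = Finsupp.single a 1 - Finsupp.single b 1) : 0 ≤ β ↔ a ≤ b := by
  have key : ∀ i : Fin n, β i = (if a ≤ i.castSucc then 1 else 0) -
      (if b ≤ i.castSucc then 1 else 0) := fun i => by
    rw [apply_eq_sum_typeAEmbedding, h]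
    simp [Finsupp.single_apply, Finset.sum_sub_distrib]
  constructor
  · intro hβ
    by_contra! hba
    have h1 := hβ (b.castPred (Fin.ne_last_of_lt hba))
    rw [key, Fin.castSucc_castPred, if_neg (not_le.mpr hba), if_pos le_rfl] at h1
    simp at h1
    linarith
  · intro hab i
    rw [key]
    by_cases hb : b ≤ i.castSucc
    · simp [hb, hab.trans hb]
    · rw [if_neg hb, sub_zero]
      split_ifs <;> simp

theorem mem_halfSpace_iff {w : Equiv.Perm (Fin (n + 1))} {β : Fin n →₀ ℝ} {a b : Fin (n + 1)}
    (hβ : β ∈ roots (permCoxeterSystem n))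
    (h : typeAEmbedding β = Finsupp.single a 1 - Finsupp.single b 1) :
    w ∈ halfSpace (permCoxeterSystem n) β ↔ w a ≤ w b := by
  rw [← nonneg_iff_of_typeAEmbedding (typeAEmbedding_rho w h)]
  exact ⟨fun h => h.2, fun h => ⟨rho_mem_roots hβ w, h⟩⟩

theorem exists_root_of_ne {a b : Fin (n + 1)} (hab : a ≠ b) :
    ∃ β ∈ roots (permCoxeterSystem n),
      typeAEmbedding β = Finsupp.single a 1 - Finsupp.single b 1 := by
  have hn : 0 < n := by
    by_contra! h
    have := a.isLt
    have := b.isLt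
    exact hab (Fin.ext (by omega))
  let i : Fin n := ⟨0, hn⟩
  -- A permutation with `i ↦ a` and `i + 1 ↦ b`.
  let c := Equiv.swap i.castSucc a i.succ
  have hc : c ≠ a := by
    intro h
    have h2 : Equiv.swap i.castSucc a i.succ = Equiv.swap i.castSucc a i.castSucc := by
      rw [Equiv.swap_apply_left]
      exact h
    have := congrArg Fin.val ((Equiv.swap i.castSucc a).injective h2)
    simp at this
  refine ⟨_, rho_mem_roots (simpleRoot_mem_roots i)
    (Equiv.swap c b * Equiv.swap i.castSucc a), ?_⟩
  rw [typeAEmbedding_rho _ (typeAEmbedding_simpleRoot i), Equiv.Perm.mul_apply,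
    Equiv.Perm.mul_apply, Equiv.swap_apply_left, Equiv.swap_apply_of_ne_of_ne hc.symm hab]
  change Finsupp.single a 1 - Finsupp.single (Equiv.swap c b c) 1 = _
  rw [Equiv.swap_apply_left]

end TypeA

/-! ### Linear extensions form a convex set -/

section LinearExtensions

theorem exists_equiv_fin_monotone {α : Type*} [Fintype α] [PartialOrder α] {k : ℕ}
    (h : Fintype.card α = k) : ∃ e : α ≃ Fin k, Monotone e := by
  let ft : Fintype (LinearExtension α) := inferInstanceAs (Fintype α)
  let e := monoEquivOfFin (LinearExtension α) h
  exact ⟨e.symm.toEquiv, fun _ _ hab => e.symm.monotone (toLinearExtension.monotone hab)⟩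

variable {n : ℕ} (r : Fin (n + 1) → Fin (n + 1) → Prop) [IsPartialOrder (Fin (n + 1)) r]

theorem linearExtensions_nonempty : (linearExtensions r).Nonempty := by
  let p : PartialOrder (Fin (n + 1)) :=
    { le := r
      lt := fun a b => r a b ∧ ¬ r b a
      le_refl := refl_of r
      le_trans := fun _ _ _ => trans_of r
      le_antisymm := fun _ _ => antisymm_of r }
  obtain ⟨e, he⟩ := @exists_equiv_fin_monotone _ _ p _ (Fintype.card_fin (n + 1))
  exact ⟨e, fun a b hab => he hab⟩

variable {r} in
theorem exists_mem_linearExtensions_lt {a b : Fin (n + 1)} (hab : ¬ r a b) :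
    ∃ w ∈ linearExtensions r, w b < w a := by
  have hr : ∀ x, r x x := refl_of r
  have htr : ∀ {x y z}, r x y → r y z → r x z := trans_of r
  -- The partial order generated by `r` and the relation `b < a`.
  let r' : Fin (n + 1) → Fin (n + 1) → Prop := fun x y => r x y ∨ (r x b ∧ r a y)
  have : IsPartialOrder (Fin (n + 1)) r' :=
    { refl := fun x => Or.inl (hr x)
      trans := by
        rintro x y z (h | ⟨h1, h2⟩) (h' | ⟨h1', h2'⟩)
        · exact Or.inl (htr h h')
        · exact Or.inr ⟨htr h h1', h2'⟩
        · exact Or.inr ⟨h1, htr h2 h'⟩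
        · exact absurd (htr h2 h1') hab
      antisymm := by
        rintro x y (h | ⟨h1, h2⟩) (h' | ⟨h1', h2'⟩)
        · exact antisymm_of r h h'
        · exact absurd (htr h2' (htr h h1')) hab
        · exact absurd (htr h2 (htr h' h1)) hab
        · exact absurd (htr h2 h1') hab }
  obtain ⟨w, hw⟩ := linearExtensions_nonempty r'
  refine ⟨w, fun x y h => hw x y (Or.inl h), lt_of_le_of_ne (hw b a (Or.inr ⟨hr b, hr a⟩)) ?_⟩
  intro h
  rw [w.injective h] at hab
  exact hab (hr a)

theorem mem_rootsOf_linearExtensions_iff {β : Fin n →₀ ℝ} {a b : Fin (n + 1)}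
    (hβ : β ∈ roots (permCoxeterSystem n))
    (h : typeAEmbedding β = Finsupp.single a 1 - Finsupp.single b 1) :
    β ∈ rootsOf (permCoxeterSystem n) (linearExtensions r) ↔ r a b := by
  constructor
  · rintro ⟨-, h2⟩
    by_contra hab
    obtain ⟨w, hw, hlt⟩ := exists_mem_linearExtensions_lt hab
    exact absurd ((mem_halfSpace_iff hβ h).mp (h2 hw)) (not_le.mpr hlt)
  · intro hab
    exact ⟨hβ, fun w hw => (mem_halfSpace_iff hβ h).mpr (hw a b hab)⟩

theorem isConvex_linearExtensions :
    IsConvex (permCoxeterSystem n) (linearExtensions r) := by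
  refine Set.Subset.antisymm (fun w hw a b hab => ?_)
    (Set.subset_iInter₂ fun β hβ => hβ.2)
  rcases eq_or_ne a b with rfl | hne
  · exact le_rfl
  · obtain ⟨β, hβ, h⟩ := exists_root_of_ne hne
    exact (mem_halfSpace_iff hβ h).mp (Set.mem_iInter₂.mp hw β
      ((mem_rootsOf_linearExtensions_iff r hβ h).mpr hab))

theorem permToggle_eq_toggle (i : Fin n) (u : Equiv.Perm (Fin (n + 1))) :
    permToggle r i u = toggle (permCoxeterSystem n) (linearExtensions r) i u := by
  have h := mem_rootsOf_linearExtensions_iff r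
    (rho_mem_roots (simpleRoot_mem_roots i) u⁻¹)
    (typeAEmbedding_rho u⁻¹ (typeAEmbedding_simpleRoot i))
  by_cases hr : r (u⁻¹ i.castSucc) (u⁻¹ i.succ)
  · rw [permToggle, toggle, if_pos hr, if_pos (h.mpr hr)]
  · rw [permToggle, toggle, if_neg hr, if_neg (fun hh => hr (h.mp hh)), permCoxeterSystem_simple,
      adjSwap]

theorem permToggleWord_eq_toggleWord (Q : List (Fin n)) :
    permToggleWord r Q = toggleWord (permCoxeterSystem n) (linearExtensions r) Q := by
  induction Q with
  | nil => rfl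
  | cons i Q ih =>
    rw [permToggleWord, toggleWord, ih]
    congr 1
    exact funext (permToggle_eq_toggle r i)

/-- The order-reversing permutation makes all simple roots negative, so a word for it inside `k`
copies of an ordering of the index set bounds the number of rounds. -/
theorem iterate_permToggleWord_image_univ {c : List (Fin n)} (hnd : c.Nodup) (hall : ∀ i, i ∈ c)
    {k : ℕ} {ω : List (Fin n)} (hω : ω.Sublist (List.replicate k c).flatten)
    (hrev : ∀ x, ((permCoxeterSystem n).wordProd ω x : ℕ) = n - x) :
    (permToggleWord r c)^[k] '' Set.univ = linearExtensions r := by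
  rw [permToggleWord_eq_toggleWord]
  refine iterate_toggleWord_image_univ (linearExtensions_nonempty r) (isConvex_linearExtensions r)
    hnd hall hω fun l => ?_
  have h := typeAEmbedding_rho ((permCoxeterSystem n).wordProd ω) (typeAEmbedding_simpleRoot l)
  rw [← neg_nonneg, nonneg_iff_of_typeAEmbedding
    (a := (permCoxeterSystem n).wordProd ω l.succ) (b := (permCoxeterSystem n).wordProd ω l.castSucc)
    (by rw [map_neg, h, neg_sub]), Fin.le_def, hrev, hrev]
  exact Nat.sub_le_sub_left (by simp) n

end LinearExtensions

/-! ### Words for the order-reversing permutation -/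

section ReverseWords

variable {n : ℕ}

theorem wordProd_cons_apply (i : Fin n) (Q : List (Fin n)) (x : Fin (n + 1)) :
    (permCoxeterSystem n).wordProd (i :: Q) x =
      adjSwap i ((permCoxeterSystem n).wordProd Q x) := by
  rw [CoxeterSystem.wordProd_cons, permCoxeterSystem_simple, Equiv.Perm.mul_apply]

/-- The word `n-1, ..., k` represents a cycle. -/
theorem wordProd_reverse_drop_finRange (m : ℕ) : ∀ k, k + m = n → ∀ x : Fin (n + 1),
    ((permCoxeterSystem n).wordProd ((List.finRange n).drop k).reverse x : ℕ) =
      if (x : ℕ) < k then (x : ℕ) else if (x : ℕ) = k then n else x - 1 := by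
  induction m with
  | zero =>
    intro k hk x
    have := x.isLt
    rw [List.drop_eq_nil_of_le (by simp; omega)]
    simp
    split_ifs <;> omega
  | succ m ih =>
    intro k hk x
    have hlt : k < (List.finRange n).length := by simp; omega
    rw [List.drop_eq_getElem_cons hlt, List.reverse_cons, CoxeterSystem.wordProd_append,
      CoxeterSystem.wordProd_singleton, permCoxeterSystem_simple, Equiv.Perm.mul_apply,
      ih (k + 1) (by omega), adjSwap_apply_val]
    simp only [List.getElem_finRange, Fin.val_cast]
    split_ifs <;> omega

theorem exists_sublist_reversing_top (m : ℕ) : ∀ k, k + m = n → ∃ ω : List (Fin n),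
    ω.Sublist (List.replicate m (List.finRange n).reverse).flatten ∧ ∀ x : Fin (n + 1),
      ((permCoxeterSystem n).wordProd ω x : ℕ) = if (x : ℕ) < k then (x : ℕ) else n + k - x := by
  induction m with
  | zero =>
    intro k hk
    refine ⟨[], by simp, fun x => ?_⟩
    have := x.isLt
    simp
    omega
  | succ m ih =>
    intro k hk
    obtain ⟨ω, h1, h2⟩ := ih (k + 1) (by omega)
    refine ⟨((List.finRange n).drop k).reverse ++ ω, ?_, fun x => ?_⟩
    · rw [List.replicate_succ, List.flatten_cons]
      exact (List.reverse_sublist.mpr (List.drop_sublist _ _)).append h1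
    · have := x.isLt
      rw [CoxeterSystem.wordProd_append, Equiv.Perm.mul_apply,
        wordProd_reverse_drop_finRange (m + 1) k hk, h2]
      split_ifs <;> omega

theorem wordProd_apply_of_forall_ne {Q : List (Fin n)} {x : Fin (n + 1)}
    (h : ∀ i ∈ Q, (x : ℕ) ≠ i ∧ (x : ℕ) ≠ i + 1) : (permCoxeterSystem n).wordProd Q x = x := by
  induction Q with
  | nil => simp
  | cons i Q ih =>
    rw [List.forall_mem_cons] at h
    rw [wordProd_cons_apply, ih h.2, adjSwap_apply_of_ne h.1.1 h.1.2]

/-- A word in letters of the same parity, each occurring once, acts by disjoint adjacent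
transpositions. -/
theorem wordProd_apply_of_mem {Q : List (Fin n)} (hnd : Q.Nodup) {p : ℕ}
    (hp : ∀ i ∈ Q, ((i : ℕ) + 1) % 2 = p) {i : Fin n} (hi : i ∈ Q) :
    (permCoxeterSystem n).wordProd Q i.castSucc = i.succ ∧
      (permCoxeterSystem n).wordProd Q i.succ = i.castSucc := by
  induction Q with
  | nil => simp at hi
  | cons k Q ih =>
    rw [List.nodup_cons] at hnd
    rw [List.forall_mem_cons] at hp
    rw [wordProd_cons_apply, wordProd_cons_apply]
    rcases List.mem_cons.mp hi with rfl | hi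
    · have hne : ∀ l ∈ Q, (l : ℕ) ≠ i := fun l hl h => hnd.1 (Fin.ext h ▸ hl)
      rw [wordProd_apply_of_forall_ne, wordProd_apply_of_forall_ne, adjSwap_apply_castSucc,
        adjSwap_apply_succ]
      · exact ⟨rfl, rfl⟩
      · intro l hl
        have := hp.2 l hl
        have := hne l hl
        simp only [Fin.val_succ]
        omega
      · intro l hl
        have := hp.2 l hl
        have := hne l hl
        simp only [Fin.val_castSucc]
        omega
    · have hne : (i : ℕ) ≠ k := fun h => hnd.1 (Fin.ext h ▸ hi)
      have := hp.2 i hi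
      rw [(ih hnd.2 hp.2 hi).1, (ih hnd.2 hp.2 hi).2, adjSwap_apply_of_ne, adjSwap_apply_of_ne]
      · exact ⟨rfl, rfl⟩
      all_goals
        simp only [Fin.val_succ, Fin.val_castSucc]
        omega

/-- The position in `{0, ..., n}` of a particle moving to the right with unit speed on the integer
line, folded by reflection at both ends of the interval. The formula is the correct one in
the range from `-(n+1)` to `2n+1`. -/
def foldPosition (n : ℕ) (z : ℤ) : ℤ :=
  if z < 0 then -1 - z else if z ≤ n then z else 2 * n + 1 - z

/-- One round of the transpositions of a fixed parity moves each particle by one step. -/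
theorem wordProd_apply_foldPosition {Q : List (Fin n)} (hnd : Q.Nodup) {p : ℕ}
    (hp : ∀ i, i ∈ Q ↔ ((i : ℕ) + 1) % 2 = p) {z : ℤ} (hz2 : z ≤ 2 * n)
    (hz : (z + 1) % 2 = p) {x : Fin (n + 1)} (hx : (x : ℤ) = foldPosition n z) :
    ((permCoxeterSystem n).wordProd Q x : ℤ) = foldPosition n (z + 1) := by
  have hxlt := x.isLt
  by_cases hr : (x : ℕ) < n ∧ ((x : ℕ) + 1) % 2 = p
  · have h1 := (wordProd_apply_of_mem hnd (fun i => (hp i).mp)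
      ((hp ⟨x, hr.1⟩).mpr hr.2)).1
    rw [show (⟨x, hr.1⟩ : Fin n).castSucc = x from rfl] at h1
    rw [h1]
    simp only [Fin.succ_mk]
    unfold foldPosition at hx ⊢
    split_ifs at hx ⊢ <;> push_cast <;> omega
  by_cases hl : 0 < (x : ℕ) ∧ (x : ℕ) % 2 = p
  · have hlt : (x : ℕ) - 1 < n := by omega
    have h1 := (wordProd_apply_of_mem hnd (fun i => (hp i).mp)
      ((hp ⟨x - 1, hlt⟩).mpr (by simp only; omega))).2
    rw [show (⟨x - 1, hlt⟩ : Fin n).succ = x from Fin.ext (by simp; omega)] at h1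
    rw [h1]
    simp only [Fin.castSucc_mk]
    unfold foldPosition at hx ⊢
    split_ifs at hx ⊢ <;> omega
  · rw [wordProd_apply_of_forall_ne]
    · unfold foldPosition at hx ⊢
      split_ifs at hx ⊢ <;> omega
    · intro i hi
      have := (hp i).mp hi
      have := i.isLt
      omega

/-- The concatenation of `t` blocks, alternately `A` and `B`, beginning with `A`. -/
def alternatingBlocks {α : Type*} : ℕ → List α → List α → List α
  | 0, _, _ => []
  | t + 1, A, B => A ++ alternatingBlocks t B A

theorem alternatingBlocks_sublist {α : Type*} (A B : List α) (k : ℕ) :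
    ∀ t ≤ 2 * k, (alternatingBlocks t A B).Sublist (List.replicate k (A ++ B)).flatten := by
  induction k with
  | zero =>
    intro t ht
    rw [show t = 0 by omega]
    simp [alternatingBlocks]
  | succ k ih =>
    intro t ht
    rw [List.replicate_succ, List.flatten_cons]
    match t with
    | 0 => simp [alternatingBlocks]
    | 1 => simp [alternatingBlocks]
    | t + 2 =>
      rw [alternatingBlocks, alternatingBlocks, ← List.append_assoc]
      exact (List.Sublist.refl _).append (ih t (by omega))

theorem wordProd_alternatingBlocks_apply (t : ℕ) {A B : List (Fin n)} (hA : A.Nodup)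
    (hB : B.Nodup) {p q : ℕ} (hpq : p + q = 1) (hp : ∀ i, i ∈ A ↔ ((i : ℕ) + 1) % 2 = p)
    (hq : ∀ i, i ∈ B ↔ ((i : ℕ) + 1) % 2 = q) {z : ℤ}
    (hz2 : z + t ≤ 2 * n + 1) (hz : (z + t) % 2 = p) {x : Fin (n + 1)}
    (hx : (x : ℤ) = foldPosition n z) :
    ((permCoxeterSystem n).wordProd (alternatingBlocks t A B) x : ℤ) = foldPosition n (z + t) := by
  induction t generalizing A B p q with
  | zero => simpa [alternatingBlocks] using hx
  | succ t ih =>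
    push_cast at hz hz2 ⊢
    rw [alternatingBlocks, CoxeterSystem.wordProd_append, Equiv.Perm.mul_apply, ← add_assoc]
    exact wordProd_apply_foldPosition hA hp (by omega) (by omega)
      (ih hB hA (by omega) hq hp (by omega) (by omega))

theorem wordProd_alternatingBlocks_eq_rev {A B : List (Fin n)} (hA : A.Nodup)
    (hB : B.Nodup) (hp : ∀ i, i ∈ A ↔ ((i : ℕ) + 1) % 2 = 0)
    (hq : ∀ i, i ∈ B ↔ ((i : ℕ) + 1) % 2 = 1) (x : Fin (n + 1)) :
    ((permCoxeterSystem n).wordProd (alternatingBlocks (n + 1) A B) x : ℕ) = n - x := by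
  have hxlt := x.isLt
  -- The parity of `x` decides whether the particle starts moving to the right or to the left.
  by_cases h : ((x : ℤ) + (n + 1 : ℕ)) % 2 = 0
  · have h1 := wordProd_alternatingBlocks_apply (n + 1) hA hB (p := 0) (q := 1) rfl hp hq
      (z := x) (by push_cast; omega) h (x := x)
      (by unfold foldPosition; split_ifs <;> omega)
    unfold foldPosition at h1
    push_cast at h1
    split_ifs at h1 <;> omega
  · have h1 := wordProd_alternatingBlocks_apply (n + 1) hA hB (p := 0) (q := 1) rfl hp hq
      (z := -1 - x) (by push_cast; omega) (by push_cast at h ⊢; omega) (x := x)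
      (by unfold foldPosition; split_ifs <;> omega)
    unfold foldPosition at h1
    push_cast at h1
    split_ifs at h1 <;> omega

end ReverseWords

/-! ### Promotion and gyration -/

theorem extPromotion_iterate_image {n : ℕ} (r : Fin (n + 1) → Fin (n + 1) → Prop)
    [IsPartialOrder (Fin (n + 1)) r] :
    (extPromotion r)^[n] '' Set.univ = linearExtensions r := by
  obtain ⟨ω, h1, h2⟩ := exists_sublist_reversing_top (n := n) n 0 (by omega)
  exact iterate_permToggleWord_image_univ r (List.nodup_reverse.mpr (List.nodup_finRange n))
    (by simp) h1 (by simpa using h2)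

theorem extGyration_iterate_image {n : ℕ} (r : Fin (n + 1) → Fin (n + 1) → Prop)
    [IsPartialOrder (Fin (n + 1)) r] :
    (extGyration r)^[⌈((n : ℚ) + 1) / 2⌉₊] '' Set.univ = linearExtensions r := by
  set A := (List.finRange n).filter fun i => Even (i.val + 1) with hA
  set B := (List.finRange n).filter fun i => Odd (i.val + 1) with hB
  have hAnd : A.Nodup := (List.nodup_finRange n).filter _
  have hBnd : B.Nodup := (List.nodup_finRange n).filter _
  have hp : ∀ i, i ∈ A ↔ ((i : ℕ) + 1) % 2 = 0 := fun i => by simp [hA, Nat.even_iff]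
  have hq : ∀ i, i ∈ B ↔ ((i : ℕ) + 1) % 2 = 1 := fun i => by simp [hB, Nat.odd_iff]
  have heq : extGyration r = permToggleWord r (A ++ B) := by
    simp only [permToggleWord_eq_toggleWord, toggleWord_append, extGyration, hA, hB]
  have hk : n + 1 ≤ 2 * ⌈((n : ℚ) + 1) / 2⌉₊ := by
    have := Nat.le_ceil (((n : ℚ) + 1) / 2)
    have h2 : ((n + 1 : ℕ) : ℚ) ≤ ((2 * ⌈((n : ℚ) + 1) / 2⌉₊ : ℕ) : ℚ) := by
      push_cast
      linarith
    exact_mod_cast h2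
  rw [heq]
  refine iterate_permToggleWord_image_univ r ?_ (fun i => ?_)
    (alternatingBlocks_sublist A B _ _ hk) (wordProd_alternatingBlocks_eq_rev hAnd hBnd hp hq)
  · refine List.nodup_append.mpr ⟨hAnd, hBnd, fun a ha b hb hab => ?_⟩
    have := (hp a).mp ha
    have := (hq b).mp hb
    rw [hab] at *
    omega
  · rw [List.mem_append, hp, hq]
    omega

end BenderKnuth

open BenderKnuth in
theorem corollary1p16 :
    (∀ (I : Type*) (W : Type*) [Finite I] [Group W] [Finite W] (M : CoxeterMatrix I)
        (cs : CoxeterSystem M W) (L : Set W), L.Nonempty → IsConvex cs L →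
        ∀ (x : W) (c : List I), IsCoxeterWordFor cs c x →
          (toggleWord cs L c)^[minPower cs c] '' Set.univ = L) ∧
    (∀ (n : ℕ) (r : Fin (n + 1) → Fin (n + 1) → Prop) [IsPartialOrder (Fin (n + 1)) r],
        (extPromotion r)^[n] '' Set.univ = linearExtensions r ∧
        (extGyration r)^[⌈((n : ℚ) + 1) / 2⌉₊] '' Set.univ = linearExtensions r) := by
  refine ⟨fun I W _ _ _ M cs L hL hconv x c hc => ?_, fun n r _ =>
    ⟨extPromotion_iterate_image r, extGyration_iterate_image r⟩⟩
  obtain ⟨ω, hω, -, hlong⟩ := exists_isReduced_sublist_minPower (cs := cs) hc.2.1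
  exact iterate_toggleWord_image_univ hL hconv hc.1 hc.2.1 hω hlong.rho_simpleRoot_nonpos
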